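/- **Conventions.** A distribution on $\{0,1\}^n$ is a probability mass function; $\mathcal D^{\otimes k}$ is the law of $k$ independent samples from $\mathcal D$ (a distribution on $\{0,1\}^{kn}$), and $d_{\mathrm{TV}}(P,Q)=\frac12\sum_x|P(x)-Q(x)|$. Boolean circuits have AND, OR and NOT gates of fan-in at most two; their size is the number of gates (input variables and the constants $0,1$ are not counted). For distributions $P,Q$ on $\{0,1\}^m$, $d_s(P,Q)$ is the maximum of $\bigl|\Pr_{x\sim P}[f(x)=1]-\Pr_{x\sim Q}[f(x)=1]\bigr|$ over all functions $f:\{0,1\}^m\to\{0,1\}$ computed by a circuit of size at most $s$. **Theorem.** There is an absolute constant $C\in\mathbb N$ such that for all $n,s,k\in\mathbb N$, all real $\varepsilon>0$ and all distributions $\mathcal D_0,\mathcal D_1$ on $\{0,1\}^n$, writing $K=\max(k,2)$, the following two statements hold. 1. There exist $s'\in\mathbb N$ and distributions $\widetilde{\mathcal D}_0,\widetilde{\mathcal D}_1$ on $\{0,1\}^n$ such that $$ s\le s'\le K^{1/\varepsilon^2}\Bigl(s+\bigl(K/\varepsilon\bigr)^{C}\Bigr),$$ $d_{s'}(\mathcal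 D_b,\widetilde{\mathcal D}_b)\le\varepsilon$ for each $b\in\{0,1\}$, and $$ d_{s'}(\mathcal D_0^{\otimes k},\mathcal D_1^{\otimes k})-k\varepsilon\;\le\; d_{\mathrm{TV}}(\widetilde{\mathcal D}_0^{\otimes k},\widetilde{\mathcal D}_1^{\otimes k})\;\le\; d_{s'}(\mathcal D_0^{\otimes k},\mathcal D_1^{\otimes k})+k\varepsilon .$$ 2. There exist $s'\in\mathbb N$ and distributions $\widetilde{\mathcal D}_0,\widetilde{\mathcal D}_1$ on $\{0,1\}^n$ with $\widetilde{\mathcal D}_0=\mathcal D_0$ that satisfy the same bounds $d_{s'}(\mathcal D_b,\widetilde{\mathcal D}_b)\le\varepsilon$ for $b\in\{0,1\}$ and the same chain of inequalities, where now $$ s\le s'\le K^{1/\varepsilon^4}\Bigl(s+\bigl(K/\varepsilon\bigr)^{C}\Bigr).$$ (For $k\ge 2$ one has $K=k$.) -/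

import Mathlib

open scoped ENNReal

/-- A wire feeding a gate (or the output) of a Boolean circuit with input variables indexed by `ι`
and `s` gates: an input variable, a constant bit, or the output of one of the gates. -/
inductive Wire (ι : Type) (s : ℕ) : Type
  | input (i : ι) : Wire ι s
  | const (b : Bool) : Wire ι s
  | gate (j : Fin s) : Wire ι s

/-- The bit carried by a wire, given the input bits `x` and the values `v` of the gates. -/
def Wire.value {ι : Type} {s : ℕ} (x : ι → Bool) (v : Fin s → Bool) : Wire ι s → Bool
  | .input i => x i
  | .const b => b
  | .gate j => v j

/-- Boolean circuits over the basis AND, OR, NOT with fan-in at most two and unbounded fan-out,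
as straight-line programs: every gate reads inputs, constants and earlier gates.
`BoolCircuit ι s` is the type of circuits with input variables indexed by `ι` and exactly `s`
gates. -/
inductive BoolCircuit (ι : Type) : ℕ → Type
  | nil : BoolCircuit ι 0
  | and {s : ℕ} (C : BoolCircuit ι s) (a b : Wire ι s) : BoolCircuit ι (s + 1)
  | or {s : ℕ} (C : BoolCircuit ι s) (a b : Wire ι s) : BoolCircuit ι (s + 1)
  | not {s : ℕ} (C : BoolCircuit ι s) (a : Wire ι s) : BoolCircuit ι (s + 1)

/-- The values of all gates of a circuit on the input `x`. -/
def BoolCircuit.gateValues {ι : Type} (x : ι → Bool) :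
    {s : ℕ} → BoolCircuit ι s → (Fin s → Bool)
  | _, .nil => Fin.elim0
  | _, .and C a b =>
      Fin.snoc (α := fun _ => Bool) (C.gateValues x)
        (a.value x (C.gateValues x) && b.value x (C.gateValues x))
  | _, .or C a b =>
      Fin.snoc (α := fun _ => Bool) (C.gateValues x)
        (a.value x (C.gateValues x) || b.value x (C.gateValues x))
  | _, .not C a =>
      Fin.snoc (α := fun _ => Bool) (C.gateValues x) (!(a.value x (C.gateValues x)))

/-- `f` is computed by a Boolean circuit of size (number of gates) at most `s`. -/
def HasCircuitOfSize {ι : Type} (s : ℕ) (f : (ι → Bool) → Bool) : Prop :=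
  ∃ t ≤ s, ∃ C : BoolCircuit ι t, ∃ out : Wire ι t,
    ∀ x, out.value x (C.gateValues x) = f x

/-- The probability that `f` accepts a sample from `P`. -/
noncomputable def acceptProb {ι : Type} [Fintype ι] [DecidableEq ι]
    (P : PMF (ι → Bool)) (f : (ι → Bool) → Bool) : ℝ :=
  ∑ x : ι → Bool, if f x = true then (P x).toReal else 0

/-- The best advantage of a circuit of size at most `s` in distinguishing `P` from `Q`. The
supremum is over a nonempty finite set of functions (constants are computed by circuits with no
gate). -/
noncomputable def circuitDist {ι : Type} [Fintype ι] [DecidableEq ι]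
    (s : ℕ) (P Q : PMF (ι → Bool)) : ℝ :=
  ⨆ f : {f : (ι → Bool) → Bool // HasCircuitOfSize s f},
    |acceptProb P f.1 - acceptProb Q f.1|

/-- Total variation distance of two distributions on a finite set. -/
noncomputable def tvDistance {α : Type} [Fintype α] (P Q : PMF α) : ℝ :=
  (1 / 2) * ∑ x, |(P x).toReal - (Q x).toReal|

theorem sum_iid_eq_one {n : ℕ} (P : PMF (Fin n → Bool)) (k : ℕ) :
    ∑ x : Fin k × Fin n → Bool, ∏ i : Fin k, P (fun j => x (i, j)) = 1 := by
  have h : ∑ x : Fin n → Bool, P x = 1 := by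
    rw [← tsum_fintype (L := .unconditional _)]
    exact P.tsum_coe
  have e : ∑ x : Fin k × Fin n → Bool, ∏ i : Fin k, P (fun j => x (i, j))
      = ∑ y : Fin k → Fin n → Bool, ∏ i, P (y i) :=
    Fintype.sum_equiv (Equiv.curry (Fin k) (Fin n) Bool) _ _ (fun _ => rfl)
  rw [e]
  have h2 := Finset.prod_univ_sum (fun _ : Fin k => (Finset.univ : Finset (Fin n → Bool)))
    (fun _ x => P x)
  rw [Fintype.piFinset_univ] at h2
  rw [← h2]
  simp [h]

/-- The distribution of `k` independent samples from `P`; the bit `(i, j)` is the `j`-th bit of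
the `i`-th sample. -/
noncomputable def PMF.iid {n : ℕ} (P : PMF (Fin n → Bool)) (k : ℕ) :
    PMF (Fin k × Fin n → Bool) :=
  PMF.ofFintype (fun x => ∏ i : Fin k, P (fun j => x (i, j))) (sum_iid_eq_one P k)

/-! A family of `i` tests labels each point by a vector of `i` bits, its cell. The near-optimal test
between the `k`-th powers of the two label laws is a threshold of a sum of rounded log-likelihood
ratios (`exists_threshold_test`), and such a threshold has a small circuit
(`hasCircuitOfSize_threshold`). So the total variation distance of the label powers exceeds the
circuit distance of the original powers by little (`sum_abs_labelWeight_le_circuitDist`).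

A model keeps both label laws but gives the two distributions one common conditional law inside each
cell; its powers are then no further apart than the label powers (`sum_abs_prod_model_le`). If a
circuit `g` tells a distribution from its model with advantage above `ε`, then `g` becomes a new
label. The energy `∑ q² / (c p + q)`, which lies in `[0, 1]`, grows by at least `γ ε²`
(`energy_add_le_energy_cons`), so some family within `1 / (γ ε²)` rounds has an indistinguishable
model. The circuits considered must be able to evaluate all labels on all `k` samples, so each round
multiplies the size by about `k + 1` (`exists_stable_family`); this is the source of the power of
`K`.

The symmetric model uses the conditional law of `D 0 + D 1`, with `c = 1` and `γ = 2`. The model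
with `D 0` unchanged uses the conditional law of `D 0`, except in cells where `D 1` is over `c`
times heavier. These carry `D 0`-mass at most `1 / c`, so `c` is taken of order `1 / ε`; the gain
drops to `γ = 4 / (c + 7)`, hence the larger exponent.

This bounds the distance of the powers from above only. The lower bound comes from moving the model
continuously towards the true distributions (`exists_interpolation`). -/

/-! ### Building circuits by extension, with gate counts. -/

/-- The functions carried by the wires of a circuit. -/
def BoolCircuit.funs {ι : Type} {s : ℕ} (C : BoolCircuit ι s) : Set ((ι → Bool) → Bool) :=
  {f | ∃ w : Wire ι s, ∀ x, w.value x (C.gateValues x) = f x}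

/-- A wire of a circuit, seen in the circuit with one more gate. -/
def Wire.lift {ι : Type} {s : ℕ} : Wire ι s → Wire ι (s + 1)
  | .input i => .input i
  | .const b => .const b
  | .gate j => .gate j.castSucc

theorem Wire.value_lift {ι : Type} {s : ℕ} (w : Wire ι s) (x : ι → Bool) (v : Fin s → Bool)
    (b : Bool) : w.lift.value x (Fin.snoc (α := fun _ => Bool) v b) = w.value x v := by
  cases w <;> simp [Wire.lift, Wire.value]

theorem BoolCircuit.funs_subset_and {ι : Type} {s : ℕ} (C : BoolCircuit ι s) (a b : Wire ι s) :
    C.funs ⊆ (C.and a b).funs := by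
  rintro f ⟨w, hw⟩
  exact ⟨w.lift, fun x => by rw [BoolCircuit.gateValues, Wire.value_lift, hw]⟩

theorem BoolCircuit.funs_subset_or {ι : Type} {s : ℕ} (C : BoolCircuit ι s) (a b : Wire ι s) :
    C.funs ⊆ (C.or a b).funs := by
  rintro f ⟨w, hw⟩
  exact ⟨w.lift, fun x => by rw [BoolCircuit.gateValues, Wire.value_lift, hw]⟩

theorem BoolCircuit.funs_subset_not {ι : Type} {s : ℕ} (C : BoolCircuit ι s) (a : Wire ι s) :
    C.funs ⊆ (C.not a).funs := by
  rintro f ⟨w, hw⟩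
  exact ⟨w.lift, fun x => by rw [BoolCircuit.gateValues, Wire.value_lift, hw]⟩

theorem BoolCircuit.input_mem_funs {ι : Type} {s : ℕ} (C : BoolCircuit ι s) (i : ι) :
    (fun x => x i) ∈ C.funs :=
  ⟨.input i, fun _ => rfl⟩

theorem BoolCircuit.const_mem_funs {ι : Type} {s : ℕ} (C : BoolCircuit ι s) (b : Bool) :
    (fun _ => b) ∈ C.funs :=
  ⟨.const b, fun _ => rfl⟩

theorem Wire.value_gate {ι : Type} {s : ℕ} (x : ι → Bool) (v : Fin s → Bool) (j : Fin s) :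
    (Wire.gate j : Wire ι s).value x v = v j := rfl

theorem BoolCircuit.exists_and {ι : Type} {s : ℕ} (C : BoolCircuit ι s)
    {f g : (ι → Bool) → Bool} (hf : f ∈ C.funs) (hg : g ∈ C.funs) :
    ∃ C' : BoolCircuit ι (s + 1), C.funs ⊆ C'.funs ∧ (fun x => f x && g x) ∈ C'.funs := by
  obtain ⟨a, ha⟩ := hf
  obtain ⟨b, hb⟩ := hg
  exact ⟨C.and a b, C.funs_subset_and a b, .gate (Fin.last s), fun x => by
    simp [BoolCircuit.gateValues, Wire.value_gate, ha, hb]⟩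

theorem BoolCircuit.exists_or {ι : Type} {s : ℕ} (C : BoolCircuit ι s)
    {f g : (ι → Bool) → Bool} (hf : f ∈ C.funs) (hg : g ∈ C.funs) :
    ∃ C' : BoolCircuit ι (s + 1), C.funs ⊆ C'.funs ∧ (fun x => f x || g x) ∈ C'.funs := by
  obtain ⟨a, ha⟩ := hf
  obtain ⟨b, hb⟩ := hg
  exact ⟨C.or a b, C.funs_subset_or a b, .gate (Fin.last s), fun x => by
    simp [BoolCircuit.gateValues, Wire.value_gate, ha, hb]⟩

theorem BoolCircuit.exists_not {ι : Type} {s : ℕ} (C : BoolCircuit ι s)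
    {f : (ι → Bool) → Bool} (hf : f ∈ C.funs) :
    ∃ C' : BoolCircuit ι (s + 1), C.funs ⊆ C'.funs ∧ (fun x => !f x) ∈ C'.funs := by
  obtain ⟨a, ha⟩ := hf
  exact ⟨C.not a, C.funs_subset_not a, .gate (Fin.last s), fun x => by
    simp [BoolCircuit.gateValues, Wire.value_gate, ha]⟩

/-- Running a second circuit, on renamed inputs, next to a first one. -/
theorem BoolCircuit.exists_append {ι κ : Type} (ρ : κ → ι) {s t : ℕ} (C : BoolCircuit ι s)
    (C₂ : BoolCircuit κ t) :
    ∃ C' : BoolCircuit ι (s + t), C.funs ⊆ C'.funs ∧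
      ∀ w : Wire κ t, (fun x => w.value (x ∘ ρ) (C₂.gateValues (x ∘ ρ))) ∈ C'.funs := by
  induction C₂ with
  | nil =>
    refine ⟨C, subset_rfl, fun w => ?_⟩
    cases w with
    | input i => exact C.input_mem_funs (ρ i)
    | const b => exact C.const_mem_funs b
    | gate j => exact j.elim0
  | and C₂ a b ih =>
    obtain ⟨C₁, h₁, h₂⟩ := ih
    obtain ⟨C', h₃, h₄⟩ := C₁.exists_and (h₂ a) (h₂ b)
    refine ⟨C', h₁.trans h₃, fun w => ?_⟩
    cases w with
    | input i => exact C'.input_mem_funs (ρ i)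
    | const b => exact C'.const_mem_funs b
    | gate j =>
      refine Fin.lastCases ?_ (fun j => ?_) j
      · simpa [Wire.value, BoolCircuit.gateValues] using h₄
      · simpa [Wire.value, BoolCircuit.gateValues] using h₃ (h₂ (.gate j))
  | or C₂ a b ih =>
    obtain ⟨C₁, h₁, h₂⟩ := ih
    obtain ⟨C', h₃, h₄⟩ := C₁.exists_or (h₂ a) (h₂ b)
    refine ⟨C', h₁.trans h₃, fun w => ?_⟩
    cases w with
    | input i => exact C'.input_mem_funs (ρ i)
    | const b => exact C'.const_mem_funs b
    | gate j =>
      refine Fin.lastCases ?_ (fun j => ?_) j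
      · simpa [Wire.value, BoolCircuit.gateValues] using h₄
      · simpa [Wire.value, BoolCircuit.gateValues] using h₃ (h₂ (.gate j))
  | not C₂ a ih =>
    obtain ⟨C₁, h₁, h₂⟩ := ih
    obtain ⟨C', h₃, h₄⟩ := C₁.exists_not (h₂ a)
    refine ⟨C', h₁.trans h₃, fun w => ?_⟩
    cases w with
    | input i => exact C'.input_mem_funs (ρ i)
    | const b => exact C'.const_mem_funs b
    | gate j =>
      refine Fin.lastCases ?_ (fun j => ?_) j
      · simpa [Wire.value, BoolCircuit.gateValues] using h₄
      · simpa [Wire.value, BoolCircuit.gateValues] using h₃ (h₂ (.gate j))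

/-- Every circuit computing all functions in `A` extends, by at most `c` gates, to a circuit
that also computes all functions in `B`. -/
def Derives {ι : Type} (c : ℕ) (A B : Set ((ι → Bool) → Bool)) : Prop :=
  ∀ (s : ℕ) (C : BoolCircuit ι s), A ⊆ C.funs →
    ∃ t ≤ s + c, ∃ C' : BoolCircuit ι t, C.funs ⊆ C'.funs ∧ B ⊆ C'.funs

namespace Derives

variable {ι : Type} {c d : ℕ} {A A' B B' E : Set ((ι → Bool) → Bool)}

theorem mono (h : Derives c A B) (hA : A ⊆ A') (hB : B' ⊆ B) (hc : c ≤ d) :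
    Derives d A' B' := by
  intro s C hC
  obtain ⟨t, ht, C', h₁, h₂⟩ := h s C (hA.trans hC)
  exact ⟨t, by omega, C', h₁, hB.trans h₂⟩

theorem of_subset (h : B ⊆ A) : Derives 0 A B := fun s C hC =>
  ⟨s, le_rfl, C, subset_rfl, h.trans hC⟩

theorem trans (h₁ : Derives c A B) (h₂ : Derives d (A ∪ B) E) : Derives (c + d) A (B ∪ E) := by
  intro s C hC
  obtain ⟨t, ht, C₁, h₃, h₄⟩ := h₁ s C hC
  obtain ⟨u, hu, C₂, h₅, h₆⟩ := h₂ t C₁ (Set.union_subset (hC.trans h₃) h₄)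
  exact ⟨u, by omega, C₂, h₃.trans h₅, Set.union_subset (h₄.trans h₅) h₆⟩

theorem union (h₁ : Derives c A B) (h₂ : Derives d A E) : Derives (c + d) A (B ∪ E) :=
  h₁.trans (h₂.mono Set.subset_union_left subset_rfl le_rfl)

theorem biUnion {α : Type} (Z : Finset α) (c : α → ℕ) (H : α → Set ((ι → Bool) → Bool))
    (h : ∀ z ∈ Z, Derives (c z) A (H z)) : Derives (∑ z ∈ Z, c z) A (⋃ z ∈ Z, H z) := by
  classical
  induction Z using Finset.induction_on with
  | empty => simpa using of_subset (Set.empty_subset A)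
  | insert z Z hz ih =>
    rw [Finset.sum_insert hz, Finset.set_biUnion_insert]
    exact (h z (Finset.mem_insert_self z Z)).union
      (ih fun y hy => h y (Finset.mem_insert_of_mem hy))

theorem const (b : Bool) : Derives 0 A {fun _ => b} := fun s C _ =>
  ⟨s, le_rfl, C, subset_rfl, by simpa using C.const_mem_funs b⟩

theorem of_hasCircuitOfSize {κ : Type} (ρ : κ → ι) {m : ℕ} {f : (κ → Bool) → Bool}
    (hf : HasCircuitOfSize m f) : Derives m A {fun x => f (x ∘ ρ)} := by
  intro s C _
  obtain ⟨t, ht, C₂, w, hw⟩ := hf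
  obtain ⟨C', h₁, h₂⟩ := C.exists_append ρ C₂
  refine ⟨s + t, by omega, C', h₁, ?_⟩
  simpa [hw] using h₂ w

theorem hasCircuitOfSize {f : (ι → Bool) → Bool} (h : Derives c ∅ B) (hf : f ∈ B) :
    HasCircuitOfSize c f := by
  obtain ⟨t, ht, C, -, hC⟩ := h 0 .nil (Set.empty_subset _)
  obtain ⟨w, hw⟩ := hC hf
  exact ⟨t, by omega, C, w, hw⟩

theorem mux {f g h : (ι → Bool) → Bool} (hf : f ∈ A) (hg : g ∈ A) (hh : h ∈ A) :
    Derives 4 A {fun x => if f x = true then g x else h x} := by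
  intro s C hC
  obtain ⟨C₁, s₁, m₁⟩ := C.exists_and (hC hf) (hC hg)
  obtain ⟨C₂, s₂, m₂⟩ := C₁.exists_not (s₁ (hC hf))
  obtain ⟨C₃, s₃, m₃⟩ := C₂.exists_and m₂ (s₂ (s₁ (hC hh)))
  obtain ⟨C₄, s₄, m₄⟩ := C₃.exists_or (s₃ (s₂ m₁)) m₃
  refine ⟨s + 4, le_rfl, C₄, s₁.trans (s₂.trans (s₃.trans s₄)), ?_⟩
  rw [Set.singleton_subset_iff]
  convert m₄ using 2 with x
  cases f x <;> simp

/-- Selecting one of `2 ^ i` functions by `i` bits. -/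
theorem select : ∀ {i : ℕ} {A : Set ((ι → Bool) → Bool)} (f : Fin i → (ι → Bool) → Bool)
    (G : (Fin i → Bool) → (ι → Bool) → Bool), (∀ j, f j ∈ A) → (∀ a, G a ∈ A) →
    Derives (4 * (2 ^ i - 1)) A {fun x => G (fun j => f j x) x}
  | 0, A, f, G, _, hG => by
    refine (of_subset ?_).mono subset_rfl subset_rfl (Nat.zero_le _)
    rw [Set.singleton_subset_iff]
    convert hG Fin.elim0 using 3
  | i + 1, A, f, G, hf, hG => by
    have h (b : Bool) := select (A := A) (fun j => f j.succ) (fun a => G (Fin.cons b a))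
      (fun j => hf j.succ) (fun a => hG _)
    have h₁ := ((h true).union (h false)).trans (mux (f := f 0)
      (Or.inl (hf 0)) (Or.inr (Or.inl rfl)) (Or.inr (Or.inr rfl)))
    refine h₁.mono subset_rfl ?_ ?_
    · rw [Set.singleton_subset_iff]
      right
      rw [Set.mem_singleton_iff]
      funext x
      have e : (fun j => f j x) = Fin.cons (f 0 x) (fun j : Fin i => f j.succ x) := by
        funext j
        refine Fin.cases rfl (fun j => rfl) j
      rw [e]
      cases f 0 x <;> simp
    · have := Nat.one_le_two_pow (n := i)
      rw [pow_succ]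
      omega

end Derives

/-! ### Circuits for thresholds of sums over samples. -/

/-- A threshold of a sum of integer weights, each determined by the labels of one sample. -/
theorem hasCircuitOfSize_threshold {n k i : ℕ} (f : Fin i → (Fin n → Bool) → Bool)
    (m : Fin i → ℕ) (hf : ∀ j, HasCircuitOfSize (m j) (f j)) (L : (Fin i → Bool) → ℤ) (M : ℕ)
    (hL : ∀ a, |L a| ≤ M) :
    HasCircuitOfSize (k * ∑ j, m j + 4 * k * (2 * k * M + 1) * 2 ^ i)
      (fun x : Fin k × Fin n → Bool =>
        decide (0 ≤ ∑ u : Fin k, L (fun j => f j (fun l => x (u, l))))) := by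
  let bit (u : Fin k) (j : Fin i) : (Fin k × Fin n → Bool) → Bool :=
    fun x => f j (fun l => x (u, l))
  let A : Set ((Fin k × Fin n → Bool) → Bool) := {g | ∃ u j, g = bit u j}
  have hA : Derives (k * ∑ j, m j) ∅ A := by
    have h := Derives.biUnion (A := ∅) (Finset.univ : Finset (Fin k × Fin i))
      (fun z => m z.2) (fun z => {bit z.1 z.2}) (fun z _ =>
        Derives.of_hasCircuitOfSize (fun l => (z.1, l)) (hf z.2))
    refine h.mono subset_rfl ?_ (le_of_eq ?_)
    · rintro g ⟨u, j, rfl⟩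
      simp
    · rw [Fintype.sum_prod_type]
      simp
  let w (u : ℕ) (x : Fin k × Fin n → Bool) : ℤ :=
    if h : u < k then L (fun j => bit ⟨u, h⟩ j x) else 0
  -- Dynamic programming: `σ` stands for the contribution of samples `t, ..., k - 1`, hence `|σ| ≤
  -- (k - t) M`. At `t = 0` every `V` is constant; the target is `V k 0`.
  let V (t : ℕ) (σ : ℤ) : (Fin k × Fin n → Bool) → Bool :=
    fun x => decide (0 ≤ σ + ∑ u ∈ Finset.range t, w u x)
  let Z (t : ℕ) : Finset ℤ := Finset.Icc (-((k : ℤ) - t) * M) (((k : ℤ) - t) * M)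
  have hV : ∀ t ≤ k, Derives (t * ((2 * k * M + 1) * (4 * 2 ^ i))) A
      (A ∪ ⋃ σ ∈ Z t, {V t σ}) := by
    intro t
    induction t with
    | zero =>
      intro _
      have h := Derives.biUnion (A := A) (Z 0) (fun _ => 0) (fun σ => {V 0 σ}) (fun σ _ => by
        simpa [V] using Derives.const (A := A) (decide (0 ≤ σ)))
      simpa using (Derives.of_subset (subset_refl A)).union h
    | succ t ih =>
      intro ht
      have h₀ := ih (by omega)
      have hw (x) : w t x = L (fun j => bit ⟨t, by omega⟩ j x) := dif_pos (by omega)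
      -- The labels `a` of sample `t` select which `V t (σ + L a)` equals `V (t + 1) σ`.
      have h₁ := Derives.biUnion (A := A ∪ (A ∪ ⋃ σ ∈ Z t, {V t σ})) (Z (t + 1))
        (fun _ => 4 * 2 ^ i) (fun σ => {V (t + 1) σ}) (fun σ hσ => by
          refine (Derives.select (bit ⟨t, by omega⟩) (fun a => V t (σ + L a))
            (fun j => Or.inl ⟨_, j, rfl⟩) (fun a => ?_)).mono subset_rfl ?_ (by omega)
          · refine Or.inr (Or.inr ?_)
            simp only [Set.mem_iUnion, Set.mem_singleton_iff]
            refine ⟨_, ?_, rfl⟩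
            have h₂ := abs_le.1 (hL a)
            simp only [Z, Finset.mem_Icc] at hσ ⊢
            push_cast at hσ
            constructor <;> nlinarith [hσ.1, hσ.2, h₂.1, h₂.2]
          · rw [Set.singleton_subset_iff, Set.mem_singleton_iff]
            funext x
            simp only [V, Finset.sum_range_succ, hw]
            congr 2
            ring)
      refine (h₀.trans h₁).mono subset_rfl ?_ ?_
      · exact Set.union_subset_union_left _ Set.subset_union_left
      · have hZ : (Z (t + 1)).card ≤ 2 * k * M + 1 := by
          simp only [Z, Int.card_Icc]
          have h₂ : (0 : ℤ) ≤ (k : ℤ) * M := by positivity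
          have h₃ : (0 : ℤ) ≤ (t : ℤ) * M := by positivity
          have h₄ : (0 : ℤ) ≤ M := by positivity
          rw [Int.toNat_le]
          push_cast
          nlinarith
        rw [Finset.sum_const, smul_eq_mul, add_mul t 1, one_mul]
        exact Nat.add_le_add_left (Nat.mul_le_mul_right _ hZ) _
  refine (hA.trans ((hV k le_rfl).mono Set.subset_union_right subset_rfl le_rfl)).mono
    subset_rfl subset_rfl (le_of_eq (by ring)) |>.hasCircuitOfSize ?_
  refine Or.inr (Or.inr ?_)
  simp only [Set.mem_iUnion, Set.mem_singleton_iff]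
  refine ⟨0, by simp [Z], ?_⟩
  funext x
  simp only [V, zero_add]
  congr 2
  rw [← Fin.sum_univ_eq_sum_range (fun u => w u x)]
  exact Finset.sum_congr rfl fun u _ => by simp [w, bit]

/-! ### Pushforwards of weights and product weights. -/

/-- The image of a weight function under a labelling. -/
noncomputable def pushWeight {X Λ : Type} [Fintype X] [DecidableEq Λ] (l : X → Λ) (P : X → ℝ)
    (a : Λ) : ℝ :=
  ∑ x, if l x = a then P x else 0

section Weights

variable {X Λ : Type} [Fintype X] [DecidableEq Λ]

theorem pushWeight_nonneg (l : X → Λ) {P : X → ℝ} (hP : ∀ x, 0 ≤ P x) (a : Λ) :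
    0 ≤ pushWeight l P a :=
  Finset.sum_nonneg fun x _ => by split_ifs <;> simp [hP]

theorem le_pushWeight (l : X → Λ) {P : X → ℝ} (hP : ∀ x, 0 ≤ P x) (x : X) :
    P x ≤ pushWeight l P (l x) := by
  have := Finset.single_le_sum (f := fun y => if l y = l x then P y else 0)
    (fun y _ => by split_ifs <;> simp [hP]) (Finset.mem_univ x)
  simpa [pushWeight] using this

theorem pushWeight_mul (l : X → Λ) (P : X → ℝ) (c : Λ → ℝ) (a : Λ) :
    pushWeight l (fun x => c (l x) * P x) a = c a * pushWeight l P a := by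
  simp only [pushWeight, Finset.mul_sum]
  refine Finset.sum_congr rfl fun x _ => ?_
  split_ifs with h <;> simp [h]

variable [Fintype Λ]

theorem sum_mul_pushWeight (l : X → Λ) (P : X → ℝ) (c : Λ → ℝ) :
    ∑ a, c a * pushWeight l P a = ∑ x, c (l x) * P x := by
  simp only [pushWeight, Finset.mul_sum]
  rw [Finset.sum_comm]
  simp

theorem sum_pushWeight (l : X → Λ) (P : X → ℝ) : ∑ a, pushWeight l P a = ∑ x, P x := by
  simpa using sum_mul_pushWeight l P 1

/-- Reduces any test that reads only labels to the product of the label laws. -/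
theorem sum_pi_mul_prod (k : ℕ) (l : X → Λ) (P : X → ℝ) (G : (Fin k → Λ) → ℝ) :
    ∑ x : Fin k → X, G (fun i => l (x i)) * ∏ i, P (x i) =
      ∑ y : Fin k → Λ, G y * ∏ i, pushWeight l P (y i) := by
  have h (y : Fin k → Λ) : ∏ i, pushWeight l P (y i) =
      ∑ x : Fin k → X, if (fun i => l (x i)) = y then ∏ i, P (x i) else 0 := by
    simp only [pushWeight]
    rw [Finset.prod_univ_sum, Fintype.piFinset_univ]
    refine Finset.sum_congr rfl fun x _ => ?_
    rw [Finset.prod_ite_zero]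
    simp [funext_iff]
  simp only [h, Finset.mul_sum]
  rw [Finset.sum_comm]
  simp

theorem sum_pi_succ (k : ℕ) (G : (Fin (k + 1) → X) → ℝ) :
    ∑ x, G x = ∑ a, ∑ y : Fin k → X, G (Fin.cons a y) := by
  rw [← Fintype.sum_prod_type']
  exact (Fintype.sum_equiv (Fin.consEquiv fun _ => X) _ _ fun _ => rfl).symm

theorem sum_pi_prod (k : ℕ) (P : X → ℝ) : ∑ x : Fin k → X, ∏ i, P (x i) = (∑ a, P a) ^ k := by
  classical
  have := Finset.prod_univ_sum (fun _ : Fin k => (Finset.univ : Finset X)) (fun _ x => P x)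
  rw [Fintype.piFinset_univ] at this
  rw [← this]
  simp

/-- Hybrid argument: exchanging `P` for `Q` in one coordinate costs one `ℓ¹` distance, since the
other coordinates have total mass 1. -/
theorem sum_abs_prod_sub_prod_le (k : ℕ) (P Q : X → ℝ) (hP : ∀ x, 0 ≤ P x) (hQ : ∀ x, 0 ≤ Q x)
    (hP' : ∑ x, P x = 1) (hQ' : ∑ x, Q x = 1) :
    ∑ x : Fin k → X, |∏ i, P (x i) - ∏ i, Q (x i)| ≤ k * ∑ a, |P a - Q a| := by
  induction k with
  | zero => simp
  | succ k ih =>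
    rw [sum_pi_succ]
    have h (a : X) (y : Fin k → X) :
        |∏ i, P (Fin.cons (α := fun _ => X) a y i) - ∏ i, Q (Fin.cons (α := fun _ => X) a y i)| ≤
          |P a - Q a| * ∏ i, P (y i) + Q a * |∏ i, P (y i) - ∏ i, Q (y i)| := by
      simp only [Fin.prod_univ_succ, Fin.cons_zero, Fin.cons_succ]
      have h₁ : 0 ≤ ∏ i, P (y i) := Finset.prod_nonneg fun i _ => hP _
      calc _ = |(P a - Q a) * ∏ i, P (y i) + Q a * (∏ i, P (y i) - ∏ i, Q (y i))| := by
            congr 1; ring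
        _ ≤ _ := abs_add_le _ _
        _ = _ := by rw [abs_mul, abs_mul, abs_of_nonneg h₁, abs_of_nonneg (hQ a)]
    calc _ ≤ ∑ a, ∑ y : Fin k → X, (|P a - Q a| * ∏ i, P (y i) +
            Q a * |∏ i, P (y i) - ∏ i, Q (y i)|) :=
          Finset.sum_le_sum fun a _ => Finset.sum_le_sum fun y _ => h a y
      _ = ∑ a, |P a - Q a| + ∑ y : Fin k → X, |∏ i, P (y i) - ∏ i, Q (y i)| := by
          simp only [Finset.sum_add_distrib, ← Finset.mul_sum, ← Finset.sum_mul, sum_pi_prod, hP',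
            hQ', one_pow, one_mul, mul_one]
      _ ≤ _ := by push_cast; linarith

end Weights

/-! ### The rounded likelihood-ratio test. -/

/-- An almost optimal test between the `k`-th powers of two distributions: the sign of the sum of
the rounded, smoothed log-likelihood ratios. -/
theorem exists_threshold_test {Λ : Type} [Fintype Λ] (k : ℕ) (p q : Λ → ℝ) (hp : ∀ a, 0 ≤ p a) (hq : ∀ a, 0 ≤ q a)
    (hp' : ∑ a, p a = 1) (hq' : ∑ a, q a = 1) {θ : ℝ} (hθ : 0 < θ) (hθ' : θ ≤ 1)
    (hk : 2 * (k * θ) ≤ 1) :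
    ∃ L : Λ → ℤ, (∀ a, |L a| ≤ (⌈1 / θ ^ 2⌉₊ + 1 : ℕ)) ∧
      (1 / 2) * ∑ y : Fin k → Λ, |∏ i, p (y i) - ∏ i, q (y i)| ≤
        ∑ y : Fin k → Λ, (if 0 ≤ ∑ i, L (y i) then ∏ i, q (y i) - ∏ i, p (y i) else 0) +
          6 * (k * θ) := by
  classical
  -- Smoothing keeps the ratio `q' / p'` in `[θ, 1 / θ]`, so its logarithm is at most `1 / θ` in
  -- absolute value. Rounding to multiples of `θ` then gives integers of size about `1 / θ ^ 2`,
  -- with total error at most `k θ` over `k` samples.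
  set p' : Λ → ℝ := fun a => p a + θ * q a with hp'def
  set q' : Λ → ℝ := fun a => q a + θ * p a with hq'def
  let r : Λ → ℝ := fun a => Real.log (q' a / p' a)
  let L : Λ → ℤ := fun a => ⌊r a / θ⌋
  have hp0 (a) : 0 ≤ p' a := by have := hp a; have := hq a; positivity
  have hq0 (a) : 0 ≤ q' a := by have := hp a; have := hq a; positivity
  have hpp (a) : p a ≤ p' a := by have := hq a; simp only [hp'def]; nlinarith
  have hqq (a) : q a ≤ q' a := by have := hp a; simp only [hq'def]; nlinarith
  have hpq (a) : θ * p' a ≤ q' a := by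
    have := hp a; have := hq a; simp only [hp'def, hq'def]; nlinarith [mul_nonneg hθ.le this]
  have hqp (a) : θ * q' a ≤ p' a := by
    have := hq a; have := hp a; simp only [hp'def, hq'def]; nlinarith [mul_nonneg hθ.le this]
  have hr (a) : |r a| ≤ 1 / θ := by
    rcases (hp0 a).eq_or_lt with h0 | h0
    · simp [r, ← h0, hθ.le]
    · have h1 : 0 < q' a := (mul_pos hθ h0).trans_le (hpq a)
      have hlog : Real.log (1 / θ) ≤ 1 / θ := Real.log_le_self (by positivity)
      rw [abs_le]
      constructor
      · have : Real.log θ ≤ r a := Real.log_le_log hθ (by rw [le_div_iff₀ h0]; exact hpq a)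
        rw [one_div, Real.log_inv] at hlog
        rw [one_div]; linarith
      · refine le_trans (Real.log_le_log (by positivity) ?_) hlog
        rw [div_le_div_iff₀ h0 hθ]
        linarith [hqp a]
  refine ⟨L, fun a => ?_, ?_⟩
  · have h1 : |r a / θ| ≤ 1 / θ ^ 2 := by
      rw [abs_div, abs_of_pos hθ, div_le_iff₀ hθ]
      calc _ ≤ _ := hr a
        _ = _ := by field_simp
    have h2 : (|(L a : ℝ)|) ≤ |r a / θ| + 1 := by
      have e1 := Int.floor_le (r a / θ)
      have e2 := Int.lt_floor_add_one (r a / θ)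
      have e3 := le_abs_self (r a / θ)
      have e4 := neg_abs_le (r a / θ)
      rw [abs_le]
      constructor <;> linarith
    have h3 := Nat.le_ceil (1 / θ ^ 2)
    have : (|L a| : ℝ) ≤ ((⌈1 / θ ^ 2⌉₊ + 1 : ℕ) : ℝ) := by push_cast; linarith
    exact_mod_cast this
  · have hexp (t : ℝ) (h0 : 0 ≤ t) (h1 : t ≤ 1) : Real.exp t ≤ 1 + 2 * t := by
      have := Real.abs_exp_sub_one_le (x := t) (by rwa [abs_of_nonneg h0])
      rw [abs_of_nonneg h0] at this
      linarith [le_abs_self (Real.exp t - 1)]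
    have hkθ : 0 ≤ k * θ := by positivity
    have hpow : (1 + θ) ^ k ≤ Real.exp (k * θ) := by
      rw [Real.exp_nat_mul]
      exact pow_le_pow_left₀ (by positivity) (by linarith [Real.add_one_le_exp θ]) k
    have sp' : ∑ y : Fin k → Λ, ∏ i, p' (y i) = (1 + θ) ^ k := by
      rw [sum_pi_prod]; simp [hp'def, Finset.sum_add_distrib, ← Finset.mul_sum, hp', hq']
    have sq' : ∑ y : Fin k → Λ, ∏ i, q' (y i) = (1 + θ) ^ k := by
      rw [sum_pi_prod]; simp [hq'def, Finset.sum_add_distrib, ← Finset.mul_sum, hp', hq']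
    have sp : ∑ y : Fin k → Λ, ∏ i, p (y i) = 1 := by rw [sum_pi_prod, hp', one_pow]
    have sq : ∑ y : Fin k → Λ, ∏ i, q (y i) = 1 := by rw [sum_pi_prod, hq', one_pow]
    have key (y : Fin k → Λ) (h : ∀ i, 0 < p' (y i)) : ∏ i, q' (y i) =
        Real.exp (∑ i, r (y i)) * ∏ i, p' (y i) := by
      rw [Real.exp_sum, ← Finset.prod_mul_distrib]
      refine Finset.prod_congr rfl fun i _ => ?_
      have h1 : 0 < q' (y i) := (mul_pos hθ (h i)).trans_le (hpq _)
      rw [Real.exp_log (div_pos h1 (h i)), div_mul_cancel₀ _ (h i).ne']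
    -- The term `(1 / 2) (P - Q)` sums to zero and turns `|P - Q| / 2` into the positive part of `Q
    -- - P`. If the test accepts then `P' ≤ Q'`, and if it rejects then `Q' ≤ exp (k θ) P'`; the
    -- last two terms pay for either error. Their sums are at most `2 k θ` and `4 k θ`, which gives
    -- the constant 6.
    have main (y : Fin k → Λ) :
        (1 / 2) * |∏ i, p (y i) - ∏ i, q (y i)| ≤
          (if 0 ≤ ∑ i, L (y i) then ∏ i, q (y i) - ∏ i, p (y i) else 0) +
            (1 / 2) * (∏ i, p (y i) - ∏ i, q (y i)) +
            (∏ i, q' (y i) - ∏ i, q (y i)) +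
            (Real.exp (k * θ) * ∏ i, p' (y i) - ∏ i, p (y i)) := by
      have hP : 0 ≤ ∏ i, p (y i) := Finset.prod_nonneg fun i _ => hp _
      have hQ : 0 ≤ ∏ i, q (y i) := Finset.prod_nonneg fun i _ => hq _
      have hPP : ∏ i, p (y i) ≤ ∏ i, p' (y i) :=
        Finset.prod_le_prod (fun i _ => hp _) fun i _ => hpp _
      have hQQ : ∏ i, q (y i) ≤ ∏ i, q' (y i) :=
        Finset.prod_le_prod (fun i _ => hq _) fun i _ => hqq _
      have hE : ∏ i, p' (y i) ≤ Real.exp (k * θ) * ∏ i, p' (y i) :=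
        le_mul_of_one_le_left (hP.trans hPP) (Real.one_le_exp hkθ)
      by_cases h0 : ∀ i, 0 < p' (y i)
      · have hk1 := key y h0
        split_ifs with hF
        · have : 0 ≤ ∑ i, r (y i) := by
            refine le_trans ?_ (Finset.sum_le_sum (f := fun i => θ * (L (y i) : ℝ))
              fun i _ => ?_)
            · rw [← Finset.mul_sum]
              have : (0 : ℝ) ≤ ∑ i, (L (y i) : ℝ) := by exact_mod_cast hF
              positivity
            · have := Int.floor_le (r (y i) / θ)
              rw [le_div_iff₀ hθ] at this
              linarith
          have : ∏ i, p' (y i) ≤ ∏ i, q' (y i) := by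
            rw [hk1]
            exact le_mul_of_one_le_left (hP.trans hPP) (Real.one_le_exp this)
          rcases abs_cases (∏ i, p (y i) - ∏ i, q (y i)) with h | h <;> linarith
        · have : ∑ i, r (y i) ≤ k * θ := by
            have h1 : ∑ i, r (y i) ≤ ∑ i : Fin k, (θ * (L (y i) : ℝ) + θ) := by
              refine Finset.sum_le_sum fun i _ => ?_
              have := (Int.lt_floor_add_one (r (y i) / θ)).le
              rw [div_le_iff₀ hθ] at this
              linarith
            rw [Finset.sum_add_distrib, ← Finset.mul_sum] at h1
            have h2 : ∑ i, (L (y i) : ℝ) ≤ 0 := by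
              rw [not_le] at hF
              exact_mod_cast hF.le
            simp only [Finset.sum_const, Finset.card_univ, Fintype.card_fin, nsmul_eq_mul] at h1
            nlinarith
          have : ∏ i, q' (y i) ≤ Real.exp (k * θ) * ∏ i, p' (y i) := by
            rw [hk1]
            exact mul_le_mul_of_nonneg_right (Real.exp_le_exp.2 this) (hP.trans hPP)
          rcases abs_cases (∏ i, p (y i) - ∏ i, q (y i)) with h | h <;> linarith
      -- Some coordinate has no mass under `p` or `q`, where the exponential formula fails but all
      -- four products vanish.
      · push Not at h0
        obtain ⟨i, hi⟩ := h0
        have h1 : p' (y i) = 0 := le_antisymm hi (hp0 _)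
        have h2 : q' (y i) = 0 := by
          have := hqp (y i); rw [h1] at this; nlinarith [hq0 (y i)]
        have e1 : ∏ i, p' (y i) = 0 := Finset.prod_eq_zero (Finset.mem_univ i) h1
        have e2 : ∏ i, q' (y i) = 0 := Finset.prod_eq_zero (Finset.mem_univ i) h2
        have e3 : ∏ i, p (y i) = 0 := by linarith
        have e4 : ∏ i, q (y i) = 0 := by linarith
        simp [e1, e2, e3, e4]
    have hsum := Finset.sum_le_sum fun y (_ : y ∈ Finset.univ) => main y
    simp only [Finset.sum_add_distrib, Finset.sum_sub_distrib, ← Finset.mul_sum, sp, sq, sp',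
      sq'] at hsum
    have b1 := hexp (k * θ) hkθ (by linarith)
    have b2 := hexp (2 * (k * θ)) (by linarith) hk
    have b3 : Real.exp (k * θ) * (1 + θ) ^ k ≤ Real.exp (2 * (k * θ)) := by
      rw [two_mul, Real.exp_add]
      exact mul_le_mul_of_nonneg_left hpow (Real.exp_pos _).le
    linarith

/-! ### Real-valued weights of distributions; total variation and circuit distance. -/

theorem PMF.sum_toReal {α : Type} [Fintype α] (P : PMF α) : ∑ x, (P x).toReal = 1 := by
  rw [← ENNReal.toReal_sum fun x _ => P.apply_ne_top x]
  have h := P.tsum_coe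
  rw [tsum_fintype] at h
  simp [h]

theorem PMF.ext_toReal {α : Type} {P Q : PMF α} (h : ∀ x, (P x).toReal = (Q x).toReal) :
    P = Q :=
  PMF.ext fun x => (ENNReal.toReal_eq_toReal_iff' (P.apply_ne_top x) (Q.apply_ne_top x)).1 (h x)

theorem PMF.exists_toReal_eq {α : Type} [Fintype α] (P : α → ℝ) (h₀ : ∀ x, 0 ≤ P x)
    (h₁ : ∑ x, P x = 1) : ∃ Q : PMF α, ∀ x, (Q x).toReal = P x := by
  refine ⟨PMF.ofFintype (fun x => ENNReal.ofReal (P x)) ?_, fun x => ?_⟩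
  · rw [← ENNReal.ofReal_sum_of_nonneg fun x _ => h₀ x, h₁, ENNReal.ofReal_one]
  · rw [PMF.ofFintype_apply, ENNReal.toReal_ofReal (h₀ x)]

theorem PMF.iid_toReal {n : ℕ} (P : PMF (Fin n → Bool)) (k : ℕ) (x : Fin k × Fin n → Bool) :
    (P.iid k x).toReal = ∏ i, (P fun j => x (i, j)).toReal := by
  rw [PMF.iid, PMF.ofFintype_apply, ENNReal.toReal_prod]

theorem sum_curry {n k : ℕ} (G : (Fin k → Fin n → Bool) → ℝ) :
    ∑ x : Fin k × Fin n → Bool, G (fun i j => x (i, j)) = ∑ y, G y :=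
  Fintype.sum_equiv (Equiv.curry (Fin k) (Fin n) Bool) _ _ fun _ => rfl

theorem tvDistance_iid {n : ℕ} (P Q : PMF (Fin n → Bool)) (k : ℕ) :
    tvDistance (P.iid k) (Q.iid k) = (1 / 2) * ∑ y : Fin k → Fin n → Bool,
      |∏ i, (P (y i)).toReal - ∏ i, (Q (y i)).toReal| := by
  simp only [tvDistance, PMF.iid_toReal]
  rw [sum_curry fun y => |∏ i, (P (y i)).toReal - ∏ i, (Q (y i)).toReal|]

theorem acceptProb_iid {n : ℕ} (P : PMF (Fin n → Bool)) (k : ℕ)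
    (F : (Fin k → Fin n → Bool) → Bool) :
    acceptProb (P.iid k) (fun x => F fun i j => x (i, j)) =
      ∑ y, if F y = true then ∏ i, (P (y i)).toReal else 0 := by
  simp only [acceptProb, PMF.iid_toReal]
  rw [sum_curry fun y => if F y = true then ∏ i, (P (y i)).toReal else 0]

theorem tvDistance_le_one {α : Type} [Fintype α] (P Q : PMF α) : tvDistance P Q ≤ 1 := by
  have : ∑ x, |(P x).toReal - (Q x).toReal| ≤ ∑ x, ((P x).toReal + (Q x).toReal) :=
    Finset.sum_le_sum fun x _ => by
      have h₁ : 0 ≤ (P x).toReal := ENNReal.toReal_nonneg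
      have h₂ : 0 ≤ (Q x).toReal := ENNReal.toReal_nonneg
      rw [abs_le]; constructor <;> linarith
  rw [Finset.sum_add_distrib, P.sum_toReal, Q.sum_toReal] at this
  simp only [tvDistance]
  linarith

theorem tvDistance_iid_le {n : ℕ} (P Q : PMF (Fin n → Bool)) (k : ℕ) :
    tvDistance (P.iid k) (Q.iid k) ≤ k * tvDistance P Q := by
  rw [tvDistance_iid, tvDistance]
  have := sum_abs_prod_sub_prod_le k (fun x => (P x).toReal) (fun x => (Q x).toReal)
    (fun _ => ENNReal.toReal_nonneg) (fun _ => ENNReal.toReal_nonneg) P.sum_toReal Q.sum_toReal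
  linarith

theorem tvDistance_triangle {α : Type} [Fintype α] (P Q R : PMF α) :
    tvDistance P R ≤ tvDistance P Q + tvDistance Q R := by
  simp only [tvDistance]
  rw [← mul_add, ← Finset.sum_add_distrib]
  exact mul_le_mul_of_nonneg_left (Finset.sum_le_sum fun x _ => abs_sub_le _ _ _) (by norm_num)

theorem hasCircuitOfSize_const {ι : Type} (s : ℕ) (b : Bool) :
    HasCircuitOfSize s (fun _ : ι → Bool => b) :=
  ⟨0, Nat.zero_le _, .nil, .const b, fun _ => rfl⟩

section CircuitDist

variable {ι : Type} [Fintype ι] [DecidableEq ι]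

theorem abs_acceptProb_sub_le (P Q : PMF (ι → Bool)) (f : (ι → Bool) → Bool) :
    |acceptProb P f - acceptProb Q f| ≤ tvDistance P Q := by
  have h : acceptProb P f - acceptProb Q f = ∑ x, (1 / 2) *
      ((if f x = true then (P x).toReal - (Q x).toReal else -((P x).toReal - (Q x).toReal))) := by
    -- Subtracting this null sum replaces the coefficients 1 and 0 by `1 / 2` and `-1 / 2`, which
    -- accounts for the factor `1 / 2` in the total variation distance.
    have : ∑ x, (1 / 2 : ℝ) * ((P x).toReal - (Q x).toReal) = 0 := by
      rw [← Finset.mul_sum, Finset.sum_sub_distrib, P.sum_toReal, Q.sum_toReal]; simp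
    rw [acceptProb, acceptProb, ← Finset.sum_sub_distrib, ← sub_zero (∑ x, _), ← this,
      ← Finset.sum_sub_distrib]
    refine Finset.sum_congr rfl fun x _ => ?_
    split_ifs <;> ring
  rw [h, tvDistance, Finset.mul_sum]
  refine (Finset.abs_sum_le_sum_abs _ _).trans (Finset.sum_le_sum fun x _ => ?_)
  rw [abs_mul, abs_of_pos (by norm_num : (0 : ℝ) < 1 / 2)]
  split_ifs
  · exact le_rfl
  · rw [abs_neg]

theorem abs_acceptProb_sub_le_circuitDist {s : ℕ} (P Q : PMF (ι → Bool))
    {f : (ι → Bool) → Bool} (hf : HasCircuitOfSize s f) :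
    |acceptProb P f - acceptProb Q f| ≤ circuitDist s P Q :=
  le_ciSup (f := fun f : {f : (ι → Bool) → Bool // HasCircuitOfSize s f} =>
    |acceptProb P f.1 - acceptProb Q f.1|)
    ⟨tvDistance P Q, by rintro _ ⟨f, rfl⟩; exact abs_acceptProb_sub_le P Q _⟩ ⟨f, hf⟩

theorem circuitDist_le {s : ℕ} {P Q : PMF (ι → Bool)} {c : ℝ}
    (h : ∀ f, HasCircuitOfSize s f → |acceptProb P f - acceptProb Q f| ≤ c) :
    circuitDist s P Q ≤ c :=
  haveI : Nonempty {f : (ι → Bool) → Bool // HasCircuitOfSize s f} :=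
    ⟨_, hasCircuitOfSize_const s true⟩
  ciSup_le fun f => h f.1 f.2

theorem circuitDist_le_tvDistance (s : ℕ) (P Q : PMF (ι → Bool)) :
    circuitDist s P Q ≤ tvDistance P Q :=
  circuitDist_le fun f _ => abs_acceptProb_sub_le P Q f

theorem circuitDist_nonneg (s : ℕ) (P Q : PMF (ι → Bool)) : 0 ≤ circuitDist s P Q :=
  (abs_nonneg _).trans (abs_acceptProb_sub_le_circuitDist P Q (hasCircuitOfSize_const s true))

theorem circuitDist_self (s : ℕ) (P : PMF (ι → Bool)) : circuitDist s P P = 0 :=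
  le_antisymm (circuitDist_le fun f _ => by simp) (circuitDist_nonneg s P P)

theorem acceptProb_mix {P Q R : PMF (ι → Bool)} {u : ℝ}
    (h : ∀ x, (R x).toReal = (1 - u) * (P x).toReal + u * (Q x).toReal)
    (f : (ι → Bool) → Bool) :
    acceptProb R f = (1 - u) * acceptProb P f + u * acceptProb Q f := by
  simp only [acceptProb, Finset.mul_sum, ← Finset.sum_add_distrib]
  refine Finset.sum_congr rfl fun x _ => ?_
  split_ifs <;> simp [h]

end CircuitDist

theorem PMF.exists_mix {α : Type} [Fintype α] (P Q : PMF α) {u : ℝ} (h₀ : 0 ≤ u) (h₁ : u ≤ 1) :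
    ∃ R : PMF α, ∀ x, (R x).toReal = (1 - u) * (P x).toReal + u * (Q x).toReal := by
  refine PMF.exists_toReal_eq _ (fun x => ?_) ?_
  · have h₁ : 0 ≤ 1 - u := by linarith
    positivity
  · rw [Finset.sum_add_distrib, ← Finset.mul_sum, ← Finset.mul_sum, P.sum_toReal, Q.sum_toReal]
    ring

/-! ### Interpolation between a model and the true distributions. -/

/-- Once the models are indistinguishable from the distributions and their powers are not too far
apart, mixing them with the distributions makes the distance of the powers as large as the
circuit distance. -/
theorem exists_interpolation {n k t : ℕ} {ε : ℝ} (hε : 0 ≤ ε) (D E : Fin 2 → PMF (Fin n → Bool))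
    (h₁ : ∀ b, circuitDist t (D b) (E b) ≤ ε)
    (h₂ : tvDistance ((E 0).iid k) ((E 1).iid k) ≤
      circuitDist t ((D 0).iid k) ((D 1).iid k) + k * ε) :
    ∃ D' : Fin 2 → PMF (Fin n → Bool), (E 0 = D 0 → D' 0 = D 0) ∧
      (∀ b, circuitDist t (D b) (D' b) ≤ ε) ∧
      circuitDist t ((D 0).iid k) ((D 1).iid k) - k * ε
        ≤ tvDistance ((D' 0).iid k) ((D' 1).iid k) ∧
      tvDistance ((D' 0).iid k) ((D' 1).iid k)
        ≤ circuitDist t ((D 0).iid k) ((D 1).iid k) + k * ε := by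
  have hkε : 0 ≤ k * ε := by positivity
  set d := circuitDist t ((D 0).iid k) ((D 1).iid k) with hd
  rcases le_total d (tvDistance ((E 0).iid k) ((E 1).iid k)) with h | h
  · exact ⟨E, id, h₁, by linarith, h₂⟩
  let mix (u : ℝ) (b : Fin 2) (x : Fin n → Bool) : ℝ :=
    (1 - u) * (E b x).toReal + u * (D b x).toReal
  -- The distance of the powers along the mixtures is continuous in `u`, at most `d` at the model
  -- and at least `d` at the true distributions, so it equals `d` somewhere.
  let g (u : ℝ) : ℝ := (1 / 2) * ∑ y : Fin k → Fin n → Bool,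
      |∏ i, mix u 0 (y i) - ∏ i, mix u 1 (y i)|
  have hg : Continuous g := by
    simp only [g, mix]
    fun_prop
  have hg0 : g 0 ≤ d := by
    rw [tvDistance_iid] at h
    simpa [g, mix] using h
  have hg1 : d ≤ g 1 := by
    have := circuitDist_le_tvDistance t ((D 0).iid k) ((D 1).iid k)
    rw [tvDistance_iid] at this
    simpa [g, mix] using this
  obtain ⟨u, ⟨hu0, hu1⟩, hu⟩ := intermediate_value_Icc zero_le_one hg.continuousOn ⟨hg0, hg1⟩
  choose D' hD' using fun b => PMF.exists_mix (E b) (D b) hu0 hu1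
  have htv : tvDistance ((D' 0).iid k) ((D' 1).iid k) = d := by
    rw [tvDistance_iid, ← hu]
    simp only [g, mix, hD']
  refine ⟨D', fun h0 => PMF.ext_toReal fun x => ?_, fun b => circuitDist_le fun f hf => ?_,
    by linarith, by linarith⟩
  · rw [hD', h0]; ring
  · have h3 := (abs_acceptProb_sub_le_circuitDist (D b) (E b) hf).trans (h₁ b)
    rw [acceptProb_mix (hD' b)]
    have : acceptProb (D b) f - ((1 - u) * acceptProb (E b) f + u * acceptProb (D b) f) =
        (1 - u) * (acceptProb (D b) f - acceptProb (E b) f) := by ring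
    rw [this, abs_mul, abs_of_nonneg (by linarith)]
    nlinarith [abs_nonneg (acceptProb (D b) f - acceptProb (E b) f)]

/-! ### Label laws and the distance of their powers. -/

/-- The weight of the labels of a distribution. -/
noncomputable abbrev PMF.labelWeight {X Λ : Type} [Fintype X] [DecidableEq Λ] (P : PMF X)
    (l : X → Λ) : Λ → ℝ :=
  pushWeight l fun x => (P x).toReal

theorem PMF.sum_labelWeight {X Λ : Type} [Fintype X] [Fintype Λ] [DecidableEq Λ] (P : PMF X)
    (l : X → Λ) : ∑ a, P.labelWeight l a = 1 := by
  rw [sum_pushWeight, P.sum_toReal]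

theorem PMF.labelWeight_nonneg {X Λ : Type} [Fintype X] [Fintype Λ] [DecidableEq Λ] (P : PMF X)
    (l : X → Λ) (a : Λ) : 0 ≤ P.labelWeight l a :=
  pushWeight_nonneg l (fun _ => ENNReal.toReal_nonneg) a

/-- What the labels reveal statistically is almost fully exploited by one circuit: it evaluates the
labels of each sample and applies the threshold test for the label laws. -/
theorem sum_abs_labelWeight_le_circuitDist {n k i : ℕ} (f : Fin i → (Fin n → Bool) → Bool)
    (m : Fin i → ℕ) (hf : ∀ j, HasCircuitOfSize (m j) (f j)) (P Q : PMF (Fin n → Bool))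
    {θ : ℝ} (hθ : 0 < θ) (hθ' : θ ≤ 1) (hk : 2 * (k * θ) ≤ 1) {t : ℕ}
    (ht : k * ∑ j, m j + 4 * k * (2 * k * (⌈1 / θ ^ 2⌉₊ + 1) + 1) * 2 ^ i ≤ t) :
    (1 / 2) * ∑ y : Fin k → Fin i → Bool,
      |∏ u, P.labelWeight (fun x j => f j x) (y u) -
        ∏ u, Q.labelWeight (fun x j => f j x) (y u)| ≤
      circuitDist t (P.iid k) (Q.iid k) + 6 * (k * θ) := by
  obtain ⟨L, hL, h⟩ := exists_threshold_test k (P.labelWeight fun x j => f j x)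
    (Q.labelWeight fun x j => f j x) (P.labelWeight_nonneg _) (Q.labelWeight_nonneg _)
    (P.sum_labelWeight _) (Q.sum_labelWeight _) hθ hθ' hk
  refine h.trans (add_le_add_left ?_ _)
  have hc := hasCircuitOfSize_threshold (k := k) f m hf L _ hL
  have hc' : HasCircuitOfSize t (fun x : Fin k × Fin n → Bool =>
      decide (0 ≤ ∑ u : Fin k, L (fun j => f j (fun l => x (u, l))))) := by
    obtain ⟨t', ht', C⟩ := hc
    exact ⟨t', ht'.trans ht, C⟩
  have h1 := abs_acceptProb_sub_le_circuitDist (P.iid k) (Q.iid k) hc'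
  have h2 (R : PMF (Fin n → Bool)) : acceptProb (R.iid k) (fun x : Fin k × Fin n → Bool =>
      decide (0 ≤ ∑ u : Fin k, L (fun j => f j (fun l => x (u, l))))) =
      ∑ y : Fin k → Fin i → Bool, if 0 ≤ ∑ u, L (y u) then
        ∏ u, R.labelWeight (fun x j => f j x) (y u) else 0 := by
    rw [acceptProb_iid R k (fun y => decide (0 ≤ ∑ u : Fin k, L (fun j => f j (y u))))]
    have := sum_pi_mul_prod k (fun (x : Fin n → Bool) (j : Fin i) => f j x)
      (fun x => (R x).toReal) (fun y => if 0 ≤ ∑ u, L (y u) then 1 else 0)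
    simpa [ite_mul] using this
  rw [h2, h2, abs_sub_comm, ← Finset.sum_sub_distrib] at h1
  refine le_trans (le_trans (le_of_eq ?_) (le_abs_self _)) h1
  refine Finset.sum_congr rfl fun y _ => ?_
  split_ifs <;> simp

/-- Distributions that agree with `P` and `Q` on the labels and share one conditional law given
the label are at most as distinguishable as the labels. -/
theorem sum_abs_prod_model_le {X Λ : Type} [Fintype X] [Fintype Λ] [DecidableEq Λ] (k : ℕ)
    (l : X → Λ) (p q : Λ → ℝ) (ν : X → ℝ) (hν : ∀ x, 0 ≤ ν x)
    (hν' : ∀ a, pushWeight l ν a ≤ 1) :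
    ∑ x : Fin k → X, |∏ u, (p (l (x u)) * ν (x u)) - ∏ u, (q (l (x u)) * ν (x u))| ≤
      ∑ y : Fin k → Λ, |∏ u, p (y u) - ∏ u, q (y u)| := by
  have h (x : Fin k → X) :
      |∏ u, (p (l (x u)) * ν (x u)) - ∏ u, (q (l (x u)) * ν (x u))| =
        |∏ u, p (l (x u)) - ∏ u, q (l (x u))| * ∏ u, ν (x u) := by
    rw [Finset.prod_mul_distrib, Finset.prod_mul_distrib, ← sub_mul, abs_mul,
      abs_of_nonneg (Finset.prod_nonneg fun u _ => hν (x u))]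
  simp only [h]
  rw [sum_pi_mul_prod k l ν fun y => |∏ u, p (y u) - ∏ u, q (y u)|]
  exact Finset.sum_le_sum fun y _ => mul_le_of_le_one_right (abs_nonneg _)
    (Finset.prod_le_one (fun u _ => pushWeight_nonneg l hν _) fun u _ => hν' _)

/-! ### The energy and its growth when a label is added. -/

/-- Splitting a cell gains exactly `(a B - c A)² / (A B (A + B))`; the factor 4 is `4 A B ≤ (A +
B)²`. The hypotheses `a ≤ A`, `c ≤ B` make the numerators vanish with their denominators, so
division by zero is harmless. -/
theorem sq_div_add_le {a c A B : ℝ} (ha : 0 ≤ a) (hc : 0 ≤ c) (haA : a ≤ A) (hcB : c ≤ B) :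
    (a + c) ^ 2 / (A + B) + 4 * ((a - A * (a + c) / (A + B)) ^ 2 / (A + B)) ≤
      a ^ 2 / A + c ^ 2 / B := by
  rcases (ha.trans haA).eq_or_lt with hA | hA
  · have : a = 0 := by linarith
    simp [← hA, this]
  rcases (hc.trans hcB).eq_or_lt with hB | hB
  · have : c = 0 := by linarith
    subst this
    rw [← hB]
    simp only [add_zero]
    rw [mul_div_cancel_left₀ _ hA.ne']
    simp
  have hAB : 0 < A + B := by linarith
  have e : a ^ 2 / A + c ^ 2 / B -
      ((a + c) ^ 2 / (A + B) + 4 * ((a - A * (a + c) / (A + B)) ^ 2 / (A + B))) =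
      (a * B - c * A) ^ 2 * (A - B) ^ 2 / (A * B * (A + B) ^ 3) := by
    field_simp
    ring
  have : 0 ≤ (a * B - c * A) ^ 2 * (A - B) ^ 2 / (A * B * (A + B) ^ 3) := by positivity
  linarith

/-- The energy of a pair of weight functions, a form of their chi-squared distance. -/
noncomputable def energy {Λ : Type} [Fintype Λ] (c : ℝ) (p q : Λ → ℝ) : ℝ :=
  ∑ a, q a ^ 2 / (c * p a + q a)

theorem energy_nonneg {Λ : Type} [Fintype Λ] {c : ℝ} (hc : 0 ≤ c) {p q : Λ → ℝ}
    (hp : ∀ a, 0 ≤ p a) (hq : ∀ a, 0 ≤ q a) : 0 ≤ energy c p q :=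
  Finset.sum_nonneg fun a _ => by
    have := hp a
    have := hq a
    positivity

theorem energy_le {Λ : Type} [Fintype Λ] {c : ℝ} (hc : 0 ≤ c) {p q : Λ → ℝ}
    (hp : ∀ a, 0 ≤ p a) (hq : ∀ a, 0 ≤ q a) : energy c p q ≤ ∑ a, q a :=
  Finset.sum_le_sum fun a _ => by
    have h₁ := hp a
    have h₂ := hq a
    have h₃ : 0 ≤ c * p a := by positivity
    rcases h₂.eq_or_lt with h | h
    · simp [← h]
    · rw [div_le_iff₀ (by linarith)]
      nlinarith

section Refine

variable {X : Type} {i : ℕ}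

/-- The restriction of a weight function to the points accepted by `g`. -/
def restrictWeight (g : X → Bool) (P : X → ℝ) (x : X) : ℝ := if g x = true then P x else 0

theorem restrictWeight_nonneg (g : X → Bool) {P : X → ℝ} (hP : ∀ x, 0 ≤ P x) (x : X) :
    0 ≤ restrictWeight g P x := by
  unfold restrictWeight
  split_ifs <;> simp [hP]

theorem restrictWeight_le (g : X → Bool) {P : X → ℝ} (hP : ∀ x, 0 ≤ P x) (x : X) :
    restrictWeight g P x ≤ P x := by
  unfold restrictWeight
  split_ifs <;> simp [hP]

variable [Fintype X]

theorem pushWeight_mono {Λ : Type} [DecidableEq Λ] (l : X → Λ) {P Q : X → ℝ}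
    (h : ∀ x, P x ≤ Q x) (a : Λ) : pushWeight l P a ≤ pushWeight l Q a :=
  Finset.sum_le_sum fun x _ => by split_ifs <;> simp [h]

theorem pushWeight_cons_true (f : Fin i → X → Bool) (g : X → Bool) (P : X → ℝ)
    (a : Fin i → Bool) :
    pushWeight (fun x j => (Fin.cons g f : Fin (i + 1) → X → Bool) j x) P (Fin.cons true a) =
      pushWeight (fun x j => f j x) (restrictWeight g P) a := by
  refine Finset.sum_congr rfl fun x _ => ?_
  simp only [restrictWeight, ← ite_and, funext_iff, Fin.forall_fin_succ, Fin.cons_zero,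
    Fin.cons_succ]
  congr 1
  exact propext and_comm

theorem pushWeight_cons_false (f : Fin i → X → Bool) (g : X → Bool) (P : X → ℝ)
    (a : Fin i → Bool) :
    pushWeight (fun x j => (Fin.cons g f : Fin (i + 1) → X → Bool) j x) P (Fin.cons false a) =
      pushWeight (fun x j => f j x) P a -
        pushWeight (fun x j => f j x) (restrictWeight g P) a := by
  rw [pushWeight, pushWeight, pushWeight, ← Finset.sum_sub_distrib]
  refine Finset.sum_congr rfl fun x _ => ?_
  simp only [restrictWeight, funext_iff, Fin.forall_fin_succ, Fin.cons_zero, Fin.cons_succ]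
  cases g x <;> by_cases h : ∀ j, f j x = a j <;> simp [h]

/-- The new label splits every cell in two, and `sq_div_add_le` applies cell by cell. The lower
bound `w` is left free so that each model can supply a linearised form of the square, which sums
directly to its total discrepancy. -/
theorem energy_add_le_energy_cons {c : ℝ} (hc : 0 ≤ c) (f : Fin i → X → Bool) (g : X → Bool)
    {P Q : X → ℝ} (hP : ∀ x, 0 ≤ P x) (hQ : ∀ x, 0 ≤ Q x) {w : (Fin i → Bool) → ℝ}
    (hw : ∀ a, w a ≤
      let p := pushWeight (fun x j => f j x) P a
      let q := pushWeight (fun x j => f j x) Q a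
      let p' := pushWeight (fun x j => f j x) (restrictWeight g P) a
      let q' := pushWeight (fun x j => f j x) (restrictWeight g Q) a
      (q' - (c * p' + q') * q / (c * p + q)) ^ 2 / (c * p + q)) :
    energy c (pushWeight (fun x j => f j x) P) (pushWeight (fun x j => f j x) Q) + 4 * ∑ a, w a ≤
      energy c (pushWeight (fun x j => (Fin.cons g f : Fin (i + 1) → X → Bool) j x) P)
        (pushWeight (fun x j => (Fin.cons g f : Fin (i + 1) → X → Bool) j x) Q) := by
  rw [energy, energy, sum_pi_succ, Fintype.sum_bool, ← Finset.sum_add_distrib, Finset.mul_sum,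
    ← Finset.sum_add_distrib]
  refine Finset.sum_le_sum fun a _ => ?_
  rw [pushWeight_cons_true, pushWeight_cons_true, pushWeight_cons_false, pushWeight_cons_false]
  have hp' := pushWeight_nonneg (fun x j => f j x) (restrictWeight_nonneg g hP) a
  have hq' := pushWeight_nonneg (fun x j => f j x) (restrictWeight_nonneg g hQ) a
  have hp := pushWeight_mono (fun x j => f j x) (restrictWeight_le g hP) a
  have hq := pushWeight_mono (fun x j => f j x) (restrictWeight_le g hQ) a
  have h := hw a
  simp only at h
  set p := pushWeight (fun x j => f j x) P a
  set q := pushWeight (fun x j => f j x) Q a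
  set p' := pushWeight (fun x j => f j x) (restrictWeight g P) a
  set q' := pushWeight (fun x j => f j x) (restrictWeight g Q) a
  have h₁ := sq_div_add_le (a := q') (c := q - q') (A := c * p' + q')
    (B := c * (p - p') + (q - q')) hq' (by linarith) (by nlinarith) (by nlinarith)
  have e₁ : q' + (q - q') = q := by ring
  have e₂ : c * p' + q' + (c * (p - p') + (q - q')) = c * p + q := by ring
  rw [e₁, e₂] at h₁
  linarith

end Refine

/-! ### The symmetric and the relative model. -/

theorem acceptProb_eq_sum_pushWeight {ι Λ : Type} [Fintype ι] [DecidableEq ι] [Fintype Λ]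
    [DecidableEq Λ] (P : PMF (ι → Bool)) (g : (ι → Bool) → Bool) (l : (ι → Bool) → Λ) :
    acceptProb P g = ∑ a, pushWeight l (restrictWeight g fun x => (P x).toReal) a :=
  (sum_pushWeight _ _).symm

theorem acceptProb_model {ι Λ : Type} [Fintype ι] [DecidableEq ι] [Fintype Λ]
    [DecidableEq Λ] {E : PMF (ι → Bool)} {l : (ι → Bool) → Λ} {p : Λ → ℝ}
    {ν : (ι → Bool) → ℝ} (hE : ∀ x, (E x).toReal = p (l x) * ν x) (g : (ι → Bool) → Bool) :
    acceptProb E g = ∑ a, p a * pushWeight l (restrictWeight g ν) a := by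
  rw [sum_mul_pushWeight]
  refine Finset.sum_congr rfl fun x _ => ?_
  rw [restrictWeight, hE]
  split_ifs <;> simp

theorem exists_model {X Λ : Type} [Fintype X] [Fintype Λ] [DecidableEq Λ] (l : X → Λ)
    (P : PMF X) {ν : X → ℝ} (hν : ∀ x, 0 ≤ ν x)
    (h : ∀ a, P.labelWeight l a * pushWeight l ν a = P.labelWeight l a) :
    ∃ E : PMF X, ∀ x, (E x).toReal = P.labelWeight l (l x) * ν x := by
  refine PMF.exists_toReal_eq _ (fun x => mul_nonneg (P.labelWeight_nonneg l _) (hν x)) ?_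
  rw [← sum_mul_pushWeight, ← P.sum_labelWeight l]
  exact Finset.sum_congr rfl fun a _ => h a

/-- Dividing by the weight of the label gives the conditional law of a point given its label. -/
theorem pushWeight_conditional {X Λ : Type} [Fintype X] [DecidableEq Λ] (l : X → Λ)
    (S : X → ℝ) (a : Λ) (g : X → Bool) :
    pushWeight l (restrictWeight g fun x => S x / pushWeight l S (l x)) a =
      pushWeight l (restrictWeight g S) a / pushWeight l S a := by
  have := pushWeight_mul l (restrictWeight g S) (fun a => (pushWeight l S a)⁻¹) a
  rw [div_eq_inv_mul, ← this]
  congr 1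
  funext x
  unfold restrictWeight
  split_ifs <;> simp [div_eq_inv_mul]

theorem pushWeight_restrict_true {X Λ : Type} [Fintype X] [DecidableEq Λ] (l : X → Λ)
    (S : X → ℝ) : pushWeight l (restrictWeight (fun _ => true) S) = pushWeight l S := by
  congr 1

theorem pushWeight_add {X Λ : Type} [Fintype X] [DecidableEq Λ] (l : X → Λ)
    (P Q : X → ℝ) (a : Λ) :
    pushWeight l (fun x => P x + Q x) a = pushWeight l P a + pushWeight l Q a := by
  simp only [pushWeight, ← Finset.sum_add_distrib]
  refine Finset.sum_congr rfl fun x _ => ?_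
  split_ifs <;> simp

theorem restrictWeight_add {X : Type} (g : X → Bool) (P Q : X → ℝ) :
    restrictWeight g (fun x => P x + Q x) =
      fun x => restrictWeight g P x + restrictWeight g Q x := by
  funext x
  unfold restrictWeight
  split_ifs <;> simp

/-- The model of both distributions for a given family of tests. -/
theorem exists_symmetric_model {n i : ℕ} (f : Fin i → (Fin n → Bool) → Bool)
    (D : Fin 2 → PMF (Fin n → Bool)) :
    ∃ E : Fin 2 → PMF (Fin n → Bool),
      (∀ k : ℕ, tvDistance ((E 0).iid k) ((E 1).iid k) ≤
        (1 / 2) * ∑ y : Fin k → Fin i → Bool,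
          |∏ u, (D 0).labelWeight (fun x j => f j x) (y u) -
            ∏ u, (D 1).labelWeight (fun x j => f j x) (y u)|) ∧
      ∀ b g, energy 1 ((D 0).labelWeight fun x j => f j x) ((D 1).labelWeight fun x j => f j x) +
          2 * (acceptProb (D b) g - acceptProb (E b) g) ^ 2 ≤
        energy 1
          ((D 0).labelWeight fun x j => (Fin.cons g f : Fin (i + 1) → (Fin n → Bool) → Bool) j x)
          ((D 1).labelWeight
            fun x j => (Fin.cons g f : Fin (i + 1) → (Fin n → Bool) → Bool) j x) := by
  set l : (Fin n → Bool) → Fin i → Bool := fun x j => f j x with hl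
  set S : (Fin n → Bool) → ℝ := fun x => (D 0 x).toReal + (D 1 x).toReal with hS
  have hD (b x) : 0 ≤ (D b x).toReal := ENNReal.toReal_nonneg
  have hS0 (x) : 0 ≤ S x := add_nonneg (hD 0 x) (hD 1 x)
  have hp (b) (a) : 0 ≤ (D b).labelWeight l a := (D b).labelWeight_nonneg l a
  have hSp (a) : pushWeight l S a = (D 0).labelWeight l a + (D 1).labelWeight l a :=
    pushWeight_add l _ _ a
  set ν : (Fin n → Bool) → ℝ := fun x => S x / pushWeight l S (l x) with hν
  have hν0 (x) : 0 ≤ ν x := div_nonneg (hS0 x) (pushWeight_nonneg l hS0 _)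
  have hνa (a) : pushWeight l ν a = pushWeight l S a / pushWeight l S a := by
    have := pushWeight_conditional l S a (fun _ => true)
    rwa [pushWeight_restrict_true, pushWeight_restrict_true] at this
  have hzero (b a) (h : pushWeight l S a = 0) : (D b).labelWeight l a = 0 := by
    have h0 := hp 0 a
    have h1 := hp 1 a
    rw [hSp] at h
    fin_cases b
    · change (D 0).labelWeight l a = 0; linarith
    · change (D 1).labelWeight l a = 0; linarith
  have hmodel (b a) : (D b).labelWeight l a * pushWeight l ν a = (D b).labelWeight l a := by
    rw [hνa]
    by_cases h : pushWeight l S a = 0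
    · rw [hzero b a h, zero_mul]
    · rw [div_self h, mul_one]
  choose E hE using fun b => exists_model l (D b) hν0 (hmodel b)
  refine ⟨E, fun k => ?_, fun b g => ?_⟩
  · rw [tvDistance_iid]
    simp only [hE]
    refine mul_le_mul_of_nonneg_left (sum_abs_prod_model_le k l _ _ ν hν0 fun a => ?_)
      (by norm_num)
    rw [hνa]
    exact div_self_le_one _
  -- `u a` is the part of the discrepancy on `g` that cell `a` contributes for `D 1`. For `D 0` it
  -- is `-u a`, since `E 0 + E 1` and `D 0 + D 1` agree.
  · set u : (Fin i → Bool) → ℝ := fun a =>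
      pushWeight l (restrictWeight g fun x => (D 1 x).toReal) a -
        (D 1).labelWeight l a * (pushWeight l (restrictWeight g S) a / pushWeight l S a) with hu
    have hSg (a) : pushWeight l (restrictWeight g S) a =
        pushWeight l (restrictWeight g fun x => (D 0 x).toReal) a +
        pushWeight l (restrictWeight g fun x => (D 1 x).toReal) a := by
      rw [hS, restrictWeight_add, pushWeight_add]
    have h1 : acceptProb (D 1) g - acceptProb (E 1) g = ∑ a, u a := by
      rw [acceptProb_eq_sum_pushWeight _ _ l, acceptProb_model (hE 1), ← Finset.sum_sub_distrib]
      refine Finset.sum_congr rfl fun a _ => ?_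
      rw [hu, hν, pushWeight_conditional]
    have h0 : acceptProb (D 0) g - acceptProb (E 0) g = -∑ a, u a := by
      rw [acceptProb_eq_sum_pushWeight _ _ l, acceptProb_model (hE 0), ← Finset.sum_sub_distrib,
        ← Finset.sum_neg_distrib]
      refine Finset.sum_congr rfl fun a _ => ?_
      rw [hu, hν, pushWeight_conditional]
      by_cases h : pushWeight l S a = 0
      · have e0 := pushWeight_mono l (restrictWeight_le g hS0) a
        have e1 := pushWeight_nonneg l (restrictWeight_nonneg g (hD 0)) a
        have e2 := pushWeight_nonneg l (restrictWeight_nonneg g (hD 1)) a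
        rw [h, hSg] at e0
        simp only [h, div_zero, mul_zero]
        linarith
      · have e := hSp a
        have : (D 0).labelWeight l a = pushWeight l S a - (D 1).labelWeight l a := by linarith
        rw [this, sub_mul, mul_div_cancel₀ _ h]
        linarith [hSg a]
    have hV : (acceptProb (D b) g - acceptProb (E b) g) ^ 2 = (∑ a, u a) ^ 2 := by
      fin_cases b
      · change (acceptProb (D 0) g - acceptProb (E 0) g) ^ 2 = _
        rw [h0, neg_sq]
      · change (acceptProb (D 1) g - acceptProb (E 1) g) ^ 2 = _
        rw [h1]
    rw [hV]
    have hgain := energy_add_le_energy_cons (c := 1) zero_le_one f g (hD 0) (hD 1)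
      -- Cauchy–Schwarz in the form `u² / S ≥ 2 τ u - τ² S`. As `S` has total mass 2, the best `τ`
      -- is half the total discrepancy `V`; the sum is then `V² / 2`, and four times this is the
      -- gain.
      (w := fun a => (∑ a, u a) * u a - ((∑ a, u a) / 2) ^ 2 * pushWeight l S a) (fun a => by
        simp only [one_mul]
        rw [← hl, ← hSp, ← hSg]
        have e : pushWeight l (restrictWeight g S) a * pushWeight l (fun x => (D 1 x).toReal) a /
            pushWeight l S a = (D 1).labelWeight l a *
              (pushWeight l (restrictWeight g S) a / pushWeight l S a) := by ring
        rw [e]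
        change _ ≤ u a ^ 2 / pushWeight l S a
        rcases (pushWeight_nonneg l hS0 a).eq_or_lt with h | h
        · have e0 := pushWeight_mono l (restrictWeight_le g (hD 1)) a
          have e2 := pushWeight_nonneg l (restrictWeight_nonneg g (hD 1)) a
          have e1 : pushWeight l (fun x => (D 1 x).toReal) a = 0 := hzero 1 a h.symm
          rw [e1] at e0
          have : u a = 0 := by simp only [hu, ← h, div_zero, mul_zero]; linarith
          simp [this, ← h]
        · rw [le_div_iff₀ h]
          nlinarith [sq_nonneg (u a - (∑ a, u a) / 2 * pushWeight l S a)])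
    rw [Finset.sum_sub_distrib, ← Finset.mul_sum, ← Finset.mul_sum, sum_pushWeight,
      Finset.sum_add_distrib, (D 0).sum_toReal, (D 1).sum_toReal] at hgain
    refine le_trans (le_of_eq ?_) hgain
    ring

/-- With `v = q' - q p' / p`, the right side is `v² (c p)² / (c p + q)³`. For `q ≤ c p` this is at
least `v² / (c p + 7 q)`, with equality of the coefficients at `q = c p`, which fixes the 7. The
left side is the linearisation of that bound. -/
theorem gain_of_ratio_le {c p q p' q' τ : ℝ} (hc : 0 < c) (hp : 0 < p) (hq : 0 ≤ q)
    (h : q ≤ c * p) :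
    2 * τ * (q' - q * (p' / p)) - τ ^ 2 * (c * p + 7 * q) ≤
      (q' - (c * p' + q') * q / (c * p + q)) ^ 2 / (c * p + q) := by
  have hA : 0 < c * p := by positivity
  have hS : 0 < c * p + q := by linarith
  have hW : 0 < c * p + 7 * q := by linarith
  set v := q' - q * (p' / p) with hv
  have e : q' - (c * p' + q') * q / (c * p + q) = c * p * v / (c * p + q) := by
    rw [hv]
    field_simp
    ring
  rw [e]
  have h₁ : 2 * τ * v - τ ^ 2 * (c * p + 7 * q) ≤ v ^ 2 / (c * p + 7 * q) := by
    rw [le_div_iff₀ hW]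
    nlinarith [sq_nonneg (v - τ * (c * p + 7 * q))]
  refine h₁.trans ?_
  have h₂ : (c * p + q) ^ 3 ≤ (c * p) ^ 2 * (c * p + 7 * q) := by
    have : 0 ≤ q * (c * p - q) * (4 * (c * p) + q) := by
      have : 0 ≤ c * p - q := by linarith
      positivity
    nlinarith
  have e₂ : (c * p * v / (c * p + q)) ^ 2 / (c * p + q) =
      v ^ 2 * ((c * p) ^ 2 / (c * p + q) ^ 3) := by
    field_simp
  rw [e₂, div_eq_mul_inv]
  refine mul_le_mul_of_nonneg_left ?_ (sq_nonneg v)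
  rw [inv_eq_one_div, div_le_div_iff₀ hW (by positivity)]
  linarith

/-- The model of the second distribution, relative to the first, for a given family of tests;
cells on which the second distribution is much heavier are not modelled. -/
theorem exists_relative_model {n i : ℕ} {c : ℝ} (hc : 0 < c)
    (f : Fin i → (Fin n → Bool) → Bool) (D : Fin 2 → PMF (Fin n → Bool)) :
    ∃ E : Fin 2 → PMF (Fin n → Bool), E 0 = D 0 ∧
      (∀ k : ℕ, tvDistance ((E 0).iid k) ((E 1).iid k) ≤
        (1 / 2) * ∑ y : Fin k → Fin i → Bool,
          |∏ u, (D 0).labelWeight (fun x j => f j x) (y u) -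
            ∏ u, (D 1).labelWeight (fun x j => f j x) (y u)| + k * (1 / c)) ∧
      ∀ b g, energy c ((D 0).labelWeight fun x j => f j x) ((D 1).labelWeight fun x j => f j x) +
          4 / (c + 7) * (acceptProb (D b) g - acceptProb (E b) g) ^ 2 ≤
        energy c
          ((D 0).labelWeight fun x j => (Fin.cons g f : Fin (i + 1) → (Fin n → Bool) → Bool) j x)
          ((D 1).labelWeight
            fun x j => (Fin.cons g f : Fin (i + 1) → (Fin n → Bool) → Bool) j x) := by
  set l : (Fin n → Bool) → Fin i → Bool := fun x j => f j x with hl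
  have hD (b x) : 0 ≤ (D b x).toReal := ENNReal.toReal_nonneg
  set p : Fin 2 → (Fin i → Bool) → ℝ := fun b => (D b).labelWeight l with hpdef
  have hp (b) (a) : 0 ≤ p b a := (D b).labelWeight_nonneg l a
  -- The model agrees with `D 0` on light cells and with `D 1` on the others. Hence the discrepancy
  -- of `D 1` comes from light cells only, and that of `D 0` from the others only.
  let light (a : Fin i → Bool) : Prop := p 1 a ≤ c * p 0 a
  classical
  let ν (x : Fin n → Bool) : ℝ :=
    if light (l x) then (D 0 x).toReal / p 0 (l x) else (D 1 x).toReal / p 1 (l x)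
  have hν0 (x) : 0 ≤ ν x := by
    have := hp 0 (l x)
    have := hp 1 (l x)
    simp only [ν]
    split_ifs <;> exact div_nonneg (hD _ _) (hp _ _)
  have hνg (g : (Fin n → Bool) → Bool) (a) : pushWeight l (restrictWeight g ν) a =
      if light a then pushWeight l (restrictWeight g fun x => (D 0 x).toReal) a / p 0 a
      else pushWeight l (restrictWeight g fun x => (D 1 x).toReal) a / p 1 a := by
    have e0 := pushWeight_conditional l (fun x => (D 0 x).toReal) a g
    have e1 := pushWeight_conditional l (fun x => (D 1 x).toReal) a g
    by_cases ha : light a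
    · rw [if_pos ha, ← e0]
      refine Finset.sum_congr rfl fun x _ => ?_
      by_cases hx : l x = a
      · rw [if_pos hx, if_pos hx]
        simp only [restrictWeight, ν, hx, if_pos ha]
        rfl
      · rw [if_neg hx, if_neg hx]
    · rw [if_neg ha, ← e1]
      refine Finset.sum_congr rfl fun x _ => ?_
      by_cases hx : l x = a
      · rw [if_pos hx, if_pos hx]
        simp only [restrictWeight, ν, hx, if_neg ha]
        rfl
      · rw [if_neg hx, if_neg hx]
  have hνa (a) : pushWeight l ν a = if light a then p 0 a / p 0 a else p 1 a / p 1 a := by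
    have := hνg (fun _ => true) a
    simpa only [pushWeight_restrict_true] using this
  have hheavy (a) (h : ¬light a) : 0 < p 1 a :=
    (mul_nonneg hc.le (hp 0 a)).trans_lt (not_le.1 h)
  have hlight (a) (h : light a) (h0 : p 0 a = 0) : p 1 a = 0 :=
    le_antisymm (by simpa [light, h0] using h) (hp 1 a)
  have hmodel (b a) : p b a * pushWeight l ν a = p b a := by
    rw [hνa]
    split_ifs with h
    · by_cases h0 : p 0 a = 0
      · have h1 := hlight a h h0
        fin_cases b
        · change p 0 a * _ = p 0 a; rw [h0, zero_mul]
        · change p 1 a * _ = p 1 a; rw [h1, zero_mul]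
      · rw [div_self h0, mul_one]
    · rw [div_self (hheavy a h).ne', mul_one]
  choose E' hE' using fun b => exists_model l (D b) hν0 (hmodel b)
  -- `D 0` and `E' 0` differ only on heavy cells and give each the same mass `p 0 a < p 1 a / c`.
  -- Putting `D 0` back in place of `E' 0` therefore costs at most `k / c` in the distance of the
  -- powers.
  have htv : tvDistance (D 0) (E' 0) ≤ 1 / c := by
    let w (a : Fin i → Bool) : ℝ := if light a then 0 else 1
    have h1 (x) : |(D 0 x).toReal - (E' 0 x).toReal| ≤
        w (l x) * (D 0 x).toReal + w (l x) * (E' 0 x).toReal := by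
      by_cases h : light (l x)
      · have : (D 0 x).toReal = (E' 0 x).toReal := by
          rw [hE']
          change _ = p 0 (l x) * ν x
          simp only [ν, if_pos h]
          by_cases h0 : p 0 (l x) = 0
          · have h2 : (D 0 x).toReal ≤ p 0 (l x) := le_pushWeight l (hD 0) x
            rw [h0, zero_mul]
            exact le_antisymm (h2.trans h0.le) (hD 0 x)
          · rw [mul_div_cancel₀ _ h0]
        simp [this, w, h]
      · simp only [w, if_neg h, one_mul]
        have h1 := hD 0 x
        have h2 : 0 ≤ (E' 0 x).toReal := ENNReal.toReal_nonneg
        rw [abs_le]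
        constructor <;> linarith
    have h2 : ∑ x, w (l x) * (E' 0 x).toReal = ∑ a, w a * p 0 a := by
      have := sum_mul_pushWeight l ν (fun a => w a * p 0 a)
      simp only [mul_assoc, hmodel] at this
      rw [this]
      exact Finset.sum_congr rfl fun x _ => by rw [hE']
    have h3 : ∑ x, w (l x) * (D 0 x).toReal = ∑ a, w a * p 0 a :=
      (sum_mul_pushWeight l _ w).symm
    have h4 : ∑ a, w a * p 0 a ≤ ∑ a, p 1 a / c := Finset.sum_le_sum fun a _ => by
      simp only [w]
      rw [le_div_iff₀ hc]
      split_ifs with h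
      · simpa using hp 1 a
      · rw [one_mul, mul_comm]
        exact (not_le.1 h).le
    rw [← Finset.sum_div, (D 1).sum_labelWeight l] at h4
    have h5 := Finset.sum_le_sum fun x (_ : x ∈ Finset.univ) => h1 x
    rw [Finset.sum_add_distrib, h2, h3] at h5
    rw [tvDistance]
    linarith
  let E : Fin 2 → PMF (Fin n → Bool) := fun b => if b = 0 then D 0 else E' 1
  refine ⟨E, rfl, fun k => ?_, fun b g => ?_⟩
  · change tvDistance ((D 0).iid k) ((E' 1).iid k) ≤ _
    have h1 := tvDistance_triangle ((D 0).iid k) ((E' 0).iid k) ((E' 1).iid k)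
    have h2 := (tvDistance_iid_le (D 0) (E' 0) k).trans
      (mul_le_mul_of_nonneg_left htv k.cast_nonneg)
    have h3 : tvDistance ((E' 0).iid k) ((E' 1).iid k) ≤
        (1 / 2) * ∑ y : Fin k → Fin i → Bool, |∏ u, p 0 (y u) - ∏ u, p 1 (y u)| := by
      rw [tvDistance_iid]
      simp only [hE']
      refine mul_le_mul_of_nonneg_left (sum_abs_prod_model_le k l _ _ ν hν0 fun a => ?_)
        (by norm_num)
      rw [hνa]
      split_ifs <;> exact div_self_le_one _
    linarith
  · set V := acceptProb (D 1) g - acceptProb (E' 1) g with hV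
    have hVb : (acceptProb (D b) g - acceptProb (E b) g) ^ 2 ≤ V ^ 2 := by
      fin_cases b
      · change (acceptProb (D 0) g - acceptProb (D 0) g) ^ 2 ≤ V ^ 2
        simpa using sq_nonneg V
      · exact le_rfl
    let v (a : Fin i → Bool) : ℝ :=
      pushWeight l (restrictWeight g fun x => (D 1 x).toReal) a -
        p 1 a * pushWeight l (restrictWeight g ν) a
    have hVsum : V = ∑ a, v a := by
      rw [hV, acceptProb_eq_sum_pushWeight _ _ l, acceptProb_model (hE' 1),
        ← Finset.sum_sub_distrib]
    set τ := V / (c + 7) with hτ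
    -- The weights `c p + 7 q` have total `c + 7`, so `τ = V / (c + 7)` is the optimal choice and
    -- yields `V² / (c + 7)`.
    have hgain := energy_add_le_energy_cons hc.le f g (hD 0) (hD 1)
      (w := fun a => 2 * τ * v a - τ ^ 2 * (c * p 0 a + 7 * p 1 a)) (fun a => by
        simp only
        rw [← hl]
        change _ ≤ (_ - _ * p 1 a / (c * p 0 a + p 1 a)) ^ 2 / (c * p 0 a + p 1 a)
        have hW : 0 ≤ τ ^ 2 * (c * p 0 a + 7 * p 1 a) := by
          have := hp 0 a
          have := hp 1 a
          positivity
        have hR : 0 ≤ (pushWeight l (restrictWeight g fun x => (D 1 x).toReal) a -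
            (c * pushWeight l (restrictWeight g fun x => (D 0 x).toReal) a +
              pushWeight l (restrictWeight g fun x => (D 1 x).toReal) a) * p 1 a /
              (c * p 0 a + p 1 a)) ^ 2 / (c * p 0 a + p 1 a) := by
          have := hp 0 a
          have := hp 1 a
          positivity
        have hle : pushWeight l (restrictWeight g fun x => (D 1 x).toReal) a ≤ p 1 a :=
          pushWeight_mono l (restrictWeight_le g (hD 1)) a
        have hge := pushWeight_nonneg l (restrictWeight_nonneg g (hD 1)) a
        by_cases h : light a
        · rcases (hp 0 a).eq_or_lt with h0 | h0
          · have h1 := hlight a h h0.symm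
            have : v a = 0 := by
              simp only [v, h1, zero_mul, sub_zero]
              linarith
            rw [this]
            linarith
          · simp only [v, hνg, if_pos h]
            exact gain_of_ratio_le hc h0 (hp 1 a) h
        · have : v a = 0 := by
            simp only [v, hνg, if_neg h]
            rw [mul_div_cancel₀ _ (hheavy a h).ne', sub_self]
          rw [this]
          linarith)
    rw [Finset.sum_sub_distrib, ← Finset.mul_sum, ← Finset.mul_sum, Finset.sum_add_distrib,
      ← Finset.mul_sum, ← Finset.mul_sum, (D 0).sum_labelWeight l, (D 1).sum_labelWeight l,
      ← hVsum] at hgain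
    have hc7 : 0 < c + 7 := by linarith
    have e : 2 * τ * V - τ ^ 2 * (c * 1 + 7 * 1) = V ^ 2 / (c + 7) := by
      rw [hτ]
      field_simp
      ring
    rw [e] at hgain
    refine le_trans (add_le_add_right ?_ _) hgain
    calc _ ≤ 4 / (c + 7) * V ^ 2 := mul_le_mul_of_nonneg_left hVb (by positivity)
      _ = _ := by ring

/-! ### Iteration and size bounds. -/

/-- If every family of tests that fails to be good for circuits of some size can be extended by
a test of that size, with an increase of a bounded potential, then some family of tests is good
for a size which exceeds the sizes of the tests. -/
theorem exists_stable_family {F : Type} (circ : ℕ → F → Prop) {k s B : ℕ} (hk : 1 ≤ k)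
    (good : (i : ℕ) → (Fin i → F) → ℕ → Prop) (Φ : (i : ℕ) → (Fin i → F) → ℝ) {γ : ℝ}
    (hγ : 0 < γ) (h₀ : ∀ f, 0 ≤ Φ 0 f) (h₁ : ∀ i f, Φ i f ≤ 1)
    (hstep : ∀ i f t, ¬good i f t → ∃ g, circ t g ∧ Φ i f + γ ≤ Φ (i + 1) (Fin.cons g f)) :
    ∃ (i : ℕ) (f : Fin i → F) (m : Fin i → ℕ), (∀ j, circ (m j) (f j)) ∧ i * γ ≤ 1 ∧
      k * ∑ j, m j + s ≤ (s + B * i) * (k + 1) ^ i ∧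
      good i f (k * ∑ j, m j + s + B * 2 ^ i) := by
  by_contra hcon
  push Not at hcon
  have key (i : ℕ) : ∃ (f : Fin i → F) (m : Fin i → ℕ), (∀ j, circ (m j) (f j)) ∧
      i * γ ≤ Φ i f ∧ k * ∑ j, m j + s ≤ (s + B * i) * (k + 1) ^ i := by
    induction i with
    | zero => exact ⟨Fin.elim0, Fin.elim0, fun j => j.elim0, by simpa using h₀ _, by simp⟩
    | succ i ih =>
      obtain ⟨f, m, hm, hΦ, hs⟩ := ih
      obtain ⟨g, hg, hgΦ⟩ := hstep i f _ (hcon i f m hm (hΦ.trans (h₁ i f)) hs)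
      -- With `S = k ∑ m + s`, the new test has size at most `S + B 2^i`, so `S` becomes `(k + 1) S
      -- + k B 2^i`; the extra term is at most `B (k + 1)^(i + 1)`.
      refine ⟨Fin.cons g f, Fin.cons (k * ∑ j, m j + s + B * 2 ^ i) m,
        Fin.cases hg hm, ?_, ?_⟩
      · push_cast
        linarith
      · rw [Fin.sum_univ_succ]
        simp only [Fin.cons_zero, Fin.cons_succ]
        have h2 : k * 2 ^ i ≤ (k + 1) ^ (i + 1) := by
          rw [pow_succ, mul_comm]
          exact Nat.mul_le_mul (Nat.pow_le_pow_left (by omega) i) (by omega)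
        calc k * (k * ∑ j, m j + s + B * 2 ^ i + ∑ j, m j) + s
            = (k + 1) * (k * ∑ j, m j + s) + B * (k * 2 ^ i) := by ring
          _ ≤ (k + 1) * ((s + B * i) * (k + 1) ^ i) + B * (k + 1) ^ (i + 1) := by gcongr
          _ = (s + B * (i + 1)) * (k + 1) ^ (i + 1) := by ring
  obtain ⟨i, hi⟩ := exists_nat_gt (1 / γ)
  obtain ⟨f, -, -, hΦ, -⟩ := key i
  rw [div_lt_iff₀ hγ] at hi
  linarith [h₁ i f]

/-- The growth factor is `k + 1` rather than `K`; the slack `5 / 8` in the number of rounds absorbs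
this through `(k + 1)^5 ≤ K^8`, which is nearly tight at `k = 2` (243 against 256). -/
theorem succ_pow_le_rpow {k i : ℕ} (hk : 1 ≤ k) {e : ℝ} (hi : i ≤ 5 / 8 * e) :
    ((k : ℝ) + 1) ^ i ≤ (max k 2 : ℝ) ^ e := by
  set K : ℝ := max k 2 with hK
  have hK2 : 2 ≤ K := le_max_right _ _
  have h5 : ((k : ℝ) + 1) ^ 5 ≤ K ^ 8 := by
    rcases Nat.lt_or_ge k 2 with h | h
    · have : k = 1 := by omega
      subst this
      calc ((1 : ℕ) + 1 : ℝ) ^ 5 ≤ 2 ^ 8 := by norm_num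
        _ ≤ K ^ 8 := by gcongr
    · have hk2 : (2 : ℝ) ≤ k := by exact_mod_cast h
      have : (k : ℝ) + 1 ≤ 3 / 2 * K := by
        have : (k : ℝ) ≤ K := le_max_left _ _
        linarith
      calc ((k : ℝ) + 1) ^ 5 ≤ (3 / 2 * K) ^ 5 := by gcongr
        _ = 243 / 32 * K ^ 5 := by ring
        _ ≤ K ^ 3 * K ^ 5 := by
          have : (2 : ℝ) ^ 3 ≤ K ^ 3 := by gcongr
          gcongr
          linarith
        _ = K ^ 8 := by ring
  have h1 : ((k : ℝ) + 1) ≤ K ^ (8 / 5 : ℝ) := by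
    refine le_of_pow_le_pow_left₀ (n := 5) (by norm_num) (by positivity) ?_
    rw [← Real.rpow_natCast (K ^ (8 / 5 : ℝ)), ← Real.rpow_mul (by linarith)]
    norm_num
    exact_mod_cast h5
  calc ((k : ℝ) + 1) ^ i ≤ (K ^ (8 / 5 : ℝ)) ^ i := by gcongr
    _ = K ^ (8 / 5 * (i : ℝ)) := by
      rw [← Real.rpow_natCast, ← Real.rpow_mul (by linarith)]
    _ ≤ K ^ e := Real.rpow_le_rpow_of_exponent_le (by linarith) (by linarith)

/-- As `x = K / ε ≥ 4`, numerical constants are absorbed into powers of `x`. The factors `4`, `k`,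
the number of partial sums and `i + 1` contribute degrees `1 + 1 + 9 + 5 = 16`. -/
theorem overhead_le {k i : ℕ} (hk : 1 ≤ k) {ε : ℝ} (hε : 0 < ε) (hε' : ε < 1 / 2)
    (hi : i ≤ 1 / ε ^ 4) :
    ((4 * k * (2 * k * (⌈1 / (ε / 18) ^ 2⌉₊ + 1) + 1) * (i + 1) : ℕ) : ℝ) ≤
      ((max k 2 : ℝ) / ε) ^ 16 := by
  set x : ℝ := (max k 2 : ℝ) / ε with hx
  have hK2 : (2 : ℝ) ≤ (max k 2 : ℝ) := le_max_right _ _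
  have hKk : (k : ℝ) ≤ (max k 2 : ℝ) := le_max_left _ _
  have hkx : (k : ℝ) ≤ x := by
    rw [hx, le_div_iff₀ hε]
    have : (0 : ℝ) ≤ k := by positivity
    nlinarith
  have hεx : 1 / ε ≤ x := by
    rw [hx]
    gcongr
    linarith
  have hx4 : 4 ≤ x := by
    rw [hx, le_div_iff₀ hε]
    linarith
  have hM : (⌈1 / (ε / 18) ^ 2⌉₊ + 1 : ℝ) ≤ x ^ 7 := by
    have h1 := (Nat.ceil_lt_add_one (a := 1 / (ε / 18) ^ 2) (by positivity)).le
    have h2 : 1 / (ε / 18) ^ 2 = 324 * (1 / ε) ^ 2 := by field_simp; norm_num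
    have h3 : (1 / ε) ^ 2 ≤ x ^ 2 := by gcongr
    have h4 : (4 : ℝ) ^ 5 ≤ x ^ 5 := by gcongr
    have h5 : (4 : ℝ) ^ 2 ≤ x ^ 2 := by gcongr
    calc _ ≤ 324 * x ^ 2 + 2 := by linarith
      _ ≤ 4 ^ 5 * x ^ 2 := by linarith
      _ ≤ x ^ 5 * x ^ 2 := by gcongr
      _ = x ^ 7 := by ring
  have hQ : 2 * (k : ℝ) * (⌈1 / (ε / 18) ^ 2⌉₊ + 1) + 1 ≤ x ^ 9 := by
    have h1 : (1 : ℝ) ≤ x ^ 8 := one_le_pow₀ (by linarith)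
    calc _ ≤ 2 * x * x ^ 7 + 1 := by gcongr
      _ ≤ 3 * x ^ 8 := by linarith
      _ ≤ x * x ^ 8 := by gcongr; linarith
      _ = x ^ 9 := by ring
  have hi5 : (i : ℝ) + 1 ≤ x ^ 5 := by
    have h1 : (1 / ε) ^ 4 ≤ x ^ 4 := by gcongr
    rw [one_div_pow] at h1
    have h2 : (1 : ℝ) ≤ x ^ 4 := one_le_pow₀ (by linarith)
    calc _ ≤ 2 * x ^ 4 := by linarith
      _ ≤ x * x ^ 4 := by gcongr; linarith
      _ = x ^ 5 := by ring
  push_cast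
  calc _ ≤ x * x * x ^ 9 * x ^ 5 := by gcongr
    _ = x ^ 16 := by ring

theorem stable_size_le {k i s t S B : ℕ} (hk : 1 ≤ k) {ε e : ℝ} (hε : 0 < ε) (hε' : ε < 1 / 2)
    (hB : B = 4 * k * (2 * k * (⌈1 / (ε / 18) ^ 2⌉₊ + 1) + 1)) (hi : i ≤ 5 / 8 * e)
    (he : e ≤ 1 / ε ^ 4) (hS : S ≤ (s + B * i) * (k + 1) ^ i) (ht : t = S + B * 2 ^ i) :
    (t : ℝ) ≤ (max k 2 : ℝ) ^ e * (s + ((max k 2 : ℝ) / ε) ^ 16) := by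
  have h1 : t ≤ (k + 1) ^ i * (s + B * (i + 1)) := by
    have : 2 ^ i ≤ (k + 1) ^ i := Nat.pow_le_pow_left (by omega) i
    calc t ≤ (s + B * i) * (k + 1) ^ i + B * (k + 1) ^ i := by rw [ht]; gcongr
      _ = _ := by ring
  have h2 : ((B * (i + 1) : ℕ) : ℝ) ≤ ((max k 2 : ℝ) / ε) ^ 16 := by
    rw [hB]
    refine overhead_le hk hε hε' ?_
    have : (0 : ℝ) ≤ i := by positivity
    linarith
  calc (t : ℝ) ≤ (((k + 1) ^ i * (s + B * (i + 1)) : ℕ) : ℝ) := by exact_mod_cast h1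
    _ = ((k : ℝ) + 1) ^ i * (s + ((B * (i + 1) : ℕ) : ℝ)) := by push_cast; ring
    _ ≤ _ := mul_le_mul (succ_pow_le_rpow hk hi) (by linarith) (by positivity)
      (Real.rpow_nonneg (le_max_of_le_right zero_le_two) _)

/-! ### Assembly. -/

/-- A model whose distances from the given distributions are certified by increments of the
energy yields a model that cannot be improved within the size bound. -/
theorem exists_stable_model {n s k : ℕ} (hk : 1 ≤ k) {ε c γ r e : ℝ} (hε : 0 < ε)
    (hε' : ε < 1 / 2) (hkε : k * ε < 1) (hc : 0 ≤ c) (hγ : 0 < γ) (hr : r ≤ 2 / 3 * ε)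
    (hγe : 1 / (γ * ε ^ 2) ≤ 5 / 8 * e) (he : e ≤ 1 / ε ^ 4) (D : Fin 2 → PMF (Fin n → Bool))
    (keep : Prop)
    (hmodel : ∀ (i : ℕ) (f : Fin i → (Fin n → Bool) → Bool),
      ∃ E : Fin 2 → PMF (Fin n → Bool), (keep → E 0 = D 0) ∧
      (∀ k : ℕ, tvDistance ((E 0).iid k) ((E 1).iid k) ≤
        (1 / 2) * ∑ y : Fin k → Fin i → Bool,
          |∏ u, (D 0).labelWeight (fun x j => f j x) (y u) -
            ∏ u, (D 1).labelWeight (fun x j => f j x) (y u)| + k * r) ∧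
      ∀ b g, energy c ((D 0).labelWeight fun x j => f j x) ((D 1).labelWeight fun x j => f j x) +
          γ * (acceptProb (D b) g - acceptProb (E b) g) ^ 2 ≤
        energy c
          ((D 0).labelWeight fun x j => (Fin.cons g f : Fin (i + 1) → (Fin n → Bool) → Bool) j x)
          ((D 1).labelWeight
            fun x j => (Fin.cons g f : Fin (i + 1) → (Fin n → Bool) → Bool) j x)) :
    ∃ (t : ℕ) (E : Fin 2 → PMF (Fin n → Bool)), (keep → E 0 = D 0) ∧ s ≤ t ∧
      (t : ℝ) ≤ (max k 2 : ℝ) ^ e * (s + ((max k 2 : ℝ) / ε) ^ 16) ∧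
      (∀ b, circuitDist t (D b) (E b) ≤ ε) ∧
      tvDistance ((E 0).iid k) ((E 1).iid k) ≤
        circuitDist t ((D 0).iid k) ((D 1).iid k) + k * ε := by
  choose E hE0 hEtv hEgain using hmodel
  obtain ⟨i, f, m, hm, hi, hS, hgood⟩ := exists_stable_family (s := s)
    (B := 4 * k * (2 * k * (⌈1 / (ε / 18) ^ 2⌉₊ + 1) + 1))
    (HasCircuitOfSize (ι := Fin n)) hk
    (fun i f t => ∀ b, circuitDist t (D b) (E i f b) ≤ ε)
    (fun i f => energy c ((D 0).labelWeight fun x j => f j x)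
      ((D 1).labelWeight fun x j => f j x))
    (γ := γ * ε ^ 2) (by positivity)
    (fun f => energy_nonneg hc ((D 0).labelWeight_nonneg _) ((D 1).labelWeight_nonneg _))
    (fun i f => (energy_le hc ((D 0).labelWeight_nonneg _) ((D 1).labelWeight_nonneg _)).trans
      ((D 1).sum_labelWeight _).le)
    (fun i f t h => by
      push Not at h
      obtain ⟨b, hb⟩ := h
      have : ∃ g, HasCircuitOfSize t g ∧ ε < |acceptProb (D b) g - acceptProb (E i f b) g| := by
        by_contra hcon
        push Not at hcon
        exact absurd (circuitDist_le hcon) (not_le.2 hb)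
      obtain ⟨g, hg, hgε⟩ := this
      refine ⟨g, hg, le_trans ?_ (hEgain i f b g)⟩
      have : ε ^ 2 ≤ (acceptProb (D b) g - acceptProb (E i f b) g) ^ 2 := by
        rw [← sq_abs (acceptProb (D b) g - _)]
        gcongr
      gcongr)
  refine ⟨_, E i f, hE0 i f, ?_, stable_size_le (e := e) hk hε hε' rfl ?_ he hS rfl, hgood, ?_⟩
  · omega
  · refine le_trans ?_ hγe
    rwa [le_div_iff₀ (by positivity)]
  · refine (hEtv i f k).trans ?_
    -- The test loses `6 k θ = k ε / 3`, leaving `2 k ε / 3` for the model's own error `k r`.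
    have := sum_abs_labelWeight_le_circuitDist (k := k) f m hm (D 0) (D 1) (θ := ε / 18)
      (by positivity) (by linarith) (by linarith)
      (t := k * ∑ j, m j + s + 4 * k * (2 * k * (⌈1 / (ε / 18) ^ 2⌉₊ + 1) + 1) * 2 ^ i) (by omega)
    have hkr : (k : ℝ) * r ≤ k * (2 / 3 * ε) := by gcongr
    linarith

/-- When `ε ≥ 1 / 2`, `k = 0` or `k ε ≥ 1`, no circuit is needed. -/
theorem exists_trivial_model {n k : ℕ} (s : ℕ) {ε : ℝ} (hε : 0 < ε)
    (h : 1 / 2 ≤ ε ∨ k = 0 ∨ 1 ≤ k * ε) (D : Fin 2 → PMF (Fin n → Bool)) :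
    ∃ E : Fin 2 → PMF (Fin n → Bool), E 0 = D 0 ∧ (∀ b, circuitDist s (D b) (E b) ≤ ε) ∧
      tvDistance ((E 0).iid k) ((E 1).iid k) ≤
        circuitDist s ((D 0).iid k) ((D 1).iid k) + k * ε := by
  have hd := circuitDist_nonneg s ((D 0).iid k) ((D 1).iid k)
  rcases h with h | h
  -- For `ε ≥ 1 / 2`, moving `D 1` by the fraction `min ε 1` towards `D 0` brings it within `ε` of
  -- both.
  · have hm0 : 0 ≤ min ε 1 := le_min hε.le zero_le_one
    have hm1 : min ε 1 ≤ 1 := min_le_right _ _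
    obtain ⟨R, hR⟩ := PMF.exists_mix (D 1) (D 0) hm0 hm1
    have hmix := acceptProb_mix hR
    refine ⟨fun b => if b = 0 then D 0 else R, rfl, fun b => ?_, ?_⟩
    · fin_cases b
      · change circuitDist s (D 0) (D 0) ≤ ε
        rw [circuitDist_self]
        exact hε.le
      · change circuitDist s (D 1) R ≤ ε
        refine circuitDist_le fun f _ => ?_
        rw [hmix]
        have h1 := (abs_acceptProb_sub_le (D 1) (D 0) f).trans (tvDistance_le_one _ _)
        have : acceptProb (D 1) f - ((1 - min ε 1) * acceptProb (D 1) f +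
            min ε 1 * acceptProb (D 0) f) =
            min ε 1 * (acceptProb (D 1) f - acceptProb (D 0) f) := by ring
        rw [this, abs_mul, abs_of_nonneg hm0]
        calc _ ≤ min ε 1 * 1 := by gcongr
          _ ≤ ε := by rw [mul_one]; exact min_le_left _ _
    · change tvDistance ((D 0).iid k) (R.iid k) ≤ _
      have h1 := tvDistance_iid_le (D 0) R k
      have h2 : tvDistance (D 0) R = (1 - min ε 1) * tvDistance (D 0) (D 1) := by
        have e (x) : (D 0 x).toReal - (R x).toReal =
            (1 - min ε 1) * ((D 0 x).toReal - (D 1 x).toReal) := by rw [hR]; ring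
        simp only [tvDistance, e, abs_mul, ← Finset.mul_sum,
          abs_of_nonneg (sub_nonneg.2 hm1)]
        ring
      have h3 : (1 - min ε 1) * tvDistance (D 0) (D 1) ≤ ε := by
        have h4 := tvDistance_le_one (D 0) (D 1)
        have h5 : 1 - min ε 1 ≤ ε := by
          rcases min_cases ε 1 with h | h <;> linarith
        calc _ ≤ (1 - min ε 1) * 1 := by gcongr
          _ ≤ ε := by linarith
      rw [h2] at h1
      have : (k : ℝ) * ((1 - min ε 1) * tvDistance (D 0) (D 1)) ≤ k * ε := by gcongr
      linarith
  · refine ⟨D, rfl, fun b => by rw [circuitDist_self]; exact hε.le, ?_⟩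
    rcases h with rfl | h
    · have := tvDistance_iid_le (D 0) (D 1) 0
      simp only [CharP.cast_eq_zero, zero_mul, add_zero] at this ⊢
      linarith
    · linarith [tvDistance_le_one ((D 0).iid k) ((D 1).iid k)]

theorem le_rpow_mul_add {s k : ℕ} {ε e : ℝ} (hε : 0 < ε) (he : 0 ≤ e) :
    (s : ℝ) ≤ (max k 2 : ℝ) ^ e * (s + ((max k 2 : ℝ) / ε) ^ 16) := by
  have hK : (2 : ℝ) ≤ (max k 2 : ℝ) := le_max_right _ _
  have h1 : 1 ≤ (max k 2 : ℝ) ^ e := Real.one_le_rpow (by linarith) he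
  have h2 : 0 ≤ ((max k 2 : ℝ) / ε) ^ 16 := by positivity
  have h3 : (0 : ℝ) ≤ s := by positivity
  nlinarith

theorem mainTheorem7 :
    ∃ C : ℕ, ∀ (n s k : ℕ) (ε : ℝ), 0 < ε → ∀ D : Fin 2 → PMF (Fin n → Bool),
      (∃ (s' : ℕ) (D' : Fin 2 → PMF (Fin n → Bool)),
        s ≤ s' ∧
        (s' : ℝ) ≤ (max k 2 : ℝ) ^ (1 / ε ^ 2) * (s + ((max k 2 : ℝ) / ε) ^ C) ∧
        (∀ b, circuitDist s' (D b) (D' b) ≤ ε) ∧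
        circuitDist s' ((D 0).iid k) ((D 1).iid k) - k * ε
          ≤ tvDistance ((D' 0).iid k) ((D' 1).iid k) ∧
        tvDistance ((D' 0).iid k) ((D' 1).iid k)
          ≤ circuitDist s' ((D 0).iid k) ((D 1).iid k) + k * ε) ∧
      (∃ (s' : ℕ) (D' : Fin 2 → PMF (Fin n → Bool)),
        D' 0 = D 0 ∧
        s ≤ s' ∧
        (s' : ℝ) ≤ (max k 2 : ℝ) ^ (1 / ε ^ 4) * (s + ((max k 2 : ℝ) / ε) ^ C) ∧
        (∀ b, circuitDist s' (D b) (D' b) ≤ ε) ∧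
        circuitDist s' ((D 0).iid k) ((D 1).iid k) - k * ε
          ≤ tvDistance ((D' 0).iid k) ((D' 1).iid k) ∧
        tvDistance ((D' 0).iid k) ((D' 1).iid k)
          ≤ circuitDist s' ((D 0).iid k) ((D 1).iid k) + k * ε) := by
  refine ⟨16, fun n s k ε hε D => ?_⟩
  by_cases h : 1 / 2 ≤ ε ∨ k = 0 ∨ 1 ≤ k * ε
  · obtain ⟨E, hE0, hE, hEtv⟩ := exists_trivial_model s hε h D
    obtain ⟨D', h0, h1, h2, h3⟩ := exists_interpolation hε.le D E hE hEtv
    exact ⟨⟨s, D', le_rfl, le_rpow_mul_add hε (by positivity), h1, h2, h3⟩,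
      ⟨s, D', h0 hE0, le_rfl, le_rpow_mul_add hε (by positivity), h1, h2, h3⟩⟩
  push Not at h
  obtain ⟨hε2, hk0, hkε⟩ := h
  have hk : 1 ≤ k := Nat.one_le_iff_ne_zero.2 hk0
  have hε1 : ε ≤ 1 := by linarith
  constructor
  · obtain ⟨t, E, -, hst, ht, hE, hEtv⟩ := exists_stable_model (s := s) (c := 1) (γ := 2)
      (r := 0) (e := 1 / ε ^ 2) hk hε hε2 hkε zero_le_one zero_lt_two (by positivity)
      (by rw [show 1 / (2 * ε ^ 2) = 1 / 2 * (1 / ε ^ 2) by field_simp]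
          exact mul_le_mul_of_nonneg_right (by norm_num) (by positivity))
      (one_div_le_one_div_of_le (by positivity) (pow_le_pow_of_le_one hε.le hε1 (by norm_num)))
      D False (fun i f => by
        obtain ⟨E, h1, h2⟩ := exists_symmetric_model f D
        exact ⟨E, False.elim, fun k => by simpa using h1 k, h2⟩)
    obtain ⟨D', -, h1, h2, h3⟩ := exists_interpolation hε.le D E hE hEtv
    exact ⟨t, D', hst, ht, h1, h2, h3⟩
  · have hc : 0 < 3 / (2 * ε) := by positivity
    -- This `c` makes `1 / c = 2 ε / 3`, the whole error budget of the model. The number of rounds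
    -- is at most `(3 / 8 * ε + 7 / 4 * ε ^ 2) / ε ^ 4`, and the bracket reaches `5 / 8` exactly at
    -- `ε = 1 / 2`.
    obtain ⟨t, E, hE0, hst, ht, hE, hEtv⟩ := exists_stable_model (s := s) (c := 3 / (2 * ε))
      (γ := 4 / (3 / (2 * ε) + 7)) (r := 1 / (3 / (2 * ε))) (e := 1 / ε ^ 4) hk hε hε2 hkε hc.le
      (by positivity) (le_of_eq (by field_simp))
      (by
        have e1 : 1 / (4 / (3 / (2 * ε) + 7) * ε ^ 2) =
            (3 / 8 * ε + 7 / 4 * ε ^ 2) * (1 / ε ^ 4) := by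
          field_simp
          ring
        rw [e1]
        gcongr
        nlinarith)
      le_rfl D True (fun i f => by
        obtain ⟨E, h0, h1, h2⟩ := exists_relative_model hc f D
        exact ⟨E, fun _ => h0, h1, h2⟩)
    obtain ⟨D', h0, h1, h2, h3⟩ := exists_interpolation hε.le D E hE hEtv
    exact ⟨t, D', h0 (hE0 trivial), hst, ht, h1, h2, h3⟩
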